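/- Let $E=(E^0,E^1,r,s)$ be a directed graph with at least one edge, let $\mathbb{K}$ be a field, and let $\mathbb{F}$ be the free group on $E^1$. Let $L_{\mathbb{K}}(E)$ be the Leavitt path algebra of $E$, that is, the (not necessarily unital) associative $\mathbb{K}$-algebra generated by pairwise orthogonal idempotents $v$ ($v\in E^0$) and elements $f, f^*$ ($f\in E^1$) subject to $s(f)f=fr(f)=f$, $r(f)f^*=f^*s(f)=f^*$, $f^*f'=\delta_{f,f'}r(f)$, and $v=\sum_{s(f)=v}ff^*$ for every $v\in E^0$ with $s^{-1}(v)$ finite and non-empty. Let $X$ be the set of all infinite paths in $E$ and all finite paths in $E$ (vertices included) that end in a sink. For $g\in\mathbb{F}$ with reduced form $ab^{-1}$, where each of $a,b$ is empty or a path of nonzero length and $r(a)=r(b)$ if both are non-empty, let $X_g\subseteq X$ be the set of paths beginning with $a$ if $a$ is non-empty, the set of paths with source $r(b)$ if $a$ is empty and $b$ is not, and $X_e=X$; let $X_g=\emptyset$ for all other $g$. The bijections $\theta_g:X_{g^{-1}}\to X_g$, $b\zeta\mapsto a\zeta$, form a partial action of $\mathbb{F}$ on $X$. Let $1_g$ and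 $1_v$ be the characteristic functions of $X_g$ and of $\{\xi\in X: s(\xi)=v\}$, let $D(X)=D_e$ be the $\mathbb{K}$-span of all $1_g$ ($g\neq e$) and all $1_v$, let $D_g=1_gD(X)$, and let $\alpha_g:D_{g^{-1}}\to D_g$, $\alpha_g(\varphi)=\varphi\circ\theta_{g^{-1}}$. Let $D(X)\star_\alpha\mathbb{F}=\bigoplus_{g\in\mathbb{F}}D_g\delta_g$ be the partial skew group ring, with product $(r\delta_g)(r'\delta_h)=\alpha_g(\alpha_{g^{-1}}(r)r')\delta_{gh}$. Give $L_{\mathbb{K}}(E)$ the $\mathbb{F}$-grading $L_{\mathbb{K}}(E)_g=\varphi^{-1}(D_g\delta_g)$ induced by the $\mathbb{K}$-algebra isomorphism $\varphi:L_{\mathbb{K}}(E)\to D(X)\star_\alpha\mathbb{F}$ with $\varphi(v)=1_v\delta_e$, $\varphi(f)=1_f\delta_f$, $\varphi(f^*)=1_{f^{-1}}\delta_{f^{-1}}$. A $G$-graded ring $R=\bigoplus_{g\in G}R_g$ is strongly graded if $R_gR_h=R_{gh}$ for all $g,h\in G$, where $R_gR_h$ is the set of finite sums of products $xy$ with $x\in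 R_g$, $y\in R_h$; it is graded clean if it has an identity and every homogeneous element (an element of some $R_g$, zero included) is the sum of a homogeneous unit and a homogeneous idempotent. Then $L_{\mathbb{K}}(E)$ is graded clean if and only if it is strongly graded, and this holds if and only if $E$ is a loop, that is, $E$ consists of exactly one vertex and exactly one edge. -/

import Mathlib

/-! ### Graded rings (not necessarily unital) -/

open Classical in
/-- The family of additive subgroups `𝓐 g` is a `G`-grading of the associative ring `R`. -/
structure IsGrading {G R : Type*} [Group G] [NonUnitalRing R] (𝓐 : G → AddSubgroup R) : Prop where
  isInternal : DirectSum.IsInternal 𝓐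
  mul_mem : ∀ {g h : G} {x y : R}, x ∈ 𝓐 g → y ∈ 𝓐 h → x * y ∈ 𝓐 (g * h)

/-- `R` is strongly graded: it is graded, and `R_g R_h = R_{gh}`, where `R_g R_h` is the set of
finite sums of products `x y` with `x ∈ R_g` and `y ∈ R_h`. -/
structure IsStronglyGraded {G R : Type*} [Group G] [NonUnitalRing R] (𝓐 : G → AddSubgroup R) : Prop
    extends IsGrading 𝓐 where
  mul_eq : ∀ g h : G, AddSubgroup.closure {z | ∃ x ∈ 𝓐 g, ∃ y ∈ 𝓐 h, z = x * y} = 𝓐 (g * h)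

/-- `R` is graded clean: it is graded, it has an identity `e`, and every homogeneous element is
the sum of a homogeneous unit and a homogeneous idempotent (here zero counts as homogeneous). -/
structure IsGradedClean {G R : Type*} [Group G] [NonUnitalRing R] (𝓐 : G → AddSubgroup R) : Prop
    extends IsGrading 𝓐 where
  clean : ∃ e : R, (∀ x, e * x = x ∧ x * e = x) ∧
    ∀ x, SetLike.IsHomogeneousElem 𝓐 x → ∃ u a : R, x = u + a ∧
      (SetLike.IsHomogeneousElem 𝓐 u ∧ ∃ w, u * w = e ∧ w * u = e) ∧
      (SetLike.IsHomogeneousElem 𝓐 a ∧ a * a = a)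

universe u v w

/-- A directed graph with vertex set `V` and edge set `A`, given by source and range maps. -/
structure DirGraph (V : Type u) (A : Type v) where
  src : A → V
  rng : A → V

namespace DirGraph

variable {V : Type u} {A : Type v}

/-- A sink is a vertex that emits no edge. -/
def IsSink (E : DirGraph V A) (x : V) : Prop := ∀ f, E.src f ≠ x

/-- The graph `E` is a loop: it consists of one vertex and one edge at that vertex. -/
def IsLoop (E : DirGraph V A) : Prop :=
  ∃ (x : V) (f : A), E.src f = x ∧ E.rng f = x ∧ (∀ y : V, y = x) ∧ (∀ f' : A, f' = f)

/-! ### The Leavitt path algebra, by generators and relations -/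

/-- Generators: vertices, edges `f`, and ghost edges `f*`. -/
inductive Gen (V : Type u) (A : Type v) : Type (max u v)
  | vert (x : V) : Gen V A
  | edge (f : A) : Gen V A
  | ghost (f : A) : Gen V A

/-- The free (non-unital, associative) `K`-algebra on the generators. -/
abbrev FreeAlg (K : Type w) [Field K] (V : Type u) (A : Type v) : Type (max u v w) :=
  MonoidAlgebra K (FreeSemigroup (Gen V A))

variable (K : Type w) [Field K]

/-- A generator, as an element of the free algebra. -/
noncomputable def gen (t : Gen V A) : FreeAlg K V A :=
  MonoidAlgebra.single (FreeSemigroup.of t) 1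

open Gen in
/-- The defining relations of the Leavitt path algebra. -/
inductive Rel (E : DirGraph V A) : FreeAlg K V A → FreeAlg K V A → Prop
  | idem (x : V) : Rel E (gen K (vert x) * gen K (vert x)) (gen K (vert x))
  | orth (x y : V) (h : x ≠ y) : Rel E (gen K (vert x) * gen K (vert y)) 0
  | src_edge (f : A) : Rel E (gen K (vert (E.src f)) * gen K (edge f)) (gen K (edge f))
  | edge_rng (f : A) : Rel E (gen K (edge f) * gen K (vert (E.rng f))) (gen K (edge f))
  | rng_ghost (f : A) : Rel E (gen K (vert (E.rng f)) * gen K (ghost f)) (gen K (ghost f))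
  | ghost_src (f : A) : Rel E (gen K (ghost f) * gen K (vert (E.src f))) (gen K (ghost f))
  | ghost_edge_same (f : A) :
      Rel E (gen K (ghost f) * gen K (edge f)) (gen K (vert (E.rng f)))
  | ghost_edge_ne (f f' : A) (h : f ≠ f') : Rel E (gen K (ghost f) * gen K (edge f')) 0
  | sum_eq (x : V) (hfin : {f | E.src f = x}.Finite) (hne : {f | E.src f = x}.Nonempty) :
      Rel E (gen K (vert x)) (∑ f ∈ hfin.toFinset, gen K (edge f) * gen K (ghost f))

/-- The ring congruence generated by all scalar multiples of the defining relations; it is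
the smallest `K`-algebra congruence that contains them. -/
noncomputable def con (E : DirGraph V A) : RingCon (FreeAlg K V A) :=
  ringConGen fun p q => ∃ (c : K) (p' q' : FreeAlg K V A), Rel K E p' q' ∧ p = c • p' ∧ q = c • q'

theorem con_smul (E : DirGraph V A) (c : K) (p q : FreeAlg K V A) (h : con K E p q) :
    con K E (c • p) (c • q) := by
  have h' : RingConGen.Rel _ p q := h
  change RingConGen.Rel _ _ _
  clear h
  induction h' with
  | of p q hpq =>
    obtain ⟨d, p', q', hr, rfl, rfl⟩ := hpq
    exact .of _ _ ⟨c * d, p', q', hr, smul_smul _ _ _, smul_smul _ _ _⟩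
  | refl x => exact .refl _
  | symm _ ih => exact .symm ih
  | trans _ _ ih1 ih2 => exact .trans ih1 ih2
  | add _ _ ih1 ih2 => rw [smul_add, smul_add]; exact .add ih1 ih2
  | mul _ h2 ih1 _ => rw [← smul_mul_assoc, ← smul_mul_assoc]; exact .mul ih1 h2

/-- The Leavitt path algebra `L_K(E)`, an associative and in general non-unital `K`-algebra. -/
def LPA (E : DirGraph V A) : Type (max u v w) := (con K E).Quotient

noncomputable instance (E : DirGraph V A) : NonUnitalRing (LPA K E) :=
  inferInstanceAs (NonUnitalRing (con K E).Quotient)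

variable {K}

/-- The quotient map from the free algebra. -/
noncomputable def toLPA (E : DirGraph V A) (p : FreeAlg K V A) : LPA K E :=
  ((p : (con K E).Quotient) : LPA K E)

theorem toLPA_surjective (E : DirGraph V A) :
    Function.Surjective (toLPA (K := K) E) := Quotient.mk''_surjective

theorem toLPA_eq (E : DirGraph V A) {p q : FreeAlg K V A} (h : con K E p q) :
    toLPA E p = toLPA E q := (RingCon.eq _).2 h

noncomputable instance (E : DirGraph V A) : SMul K (LPA K E) :=
  ⟨fun c => (con K E).smulAux (fun c p q h => con_smul K E c p q h) c⟩

theorem toLPA_add (E : DirGraph V A) (p q : FreeAlg K V A) :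
    toLPA E (p + q) = toLPA E p + toLPA E q := rfl

theorem toLPA_mul (E : DirGraph V A) (p q : FreeAlg K V A) :
    toLPA E (p * q) = toLPA E p * toLPA E q := rfl

theorem toLPA_zero (E : DirGraph V A) : toLPA E (0 : FreeAlg K V A) = 0 := rfl

theorem toLPA_smul (E : DirGraph V A) (c : K) (p : FreeAlg K V A) :
    toLPA E (c • p) = c • toLPA E p := rfl

noncomputable instance (E : DirGraph V A) : Module K (LPA K E) :=
  (toLPA_surjective E).module K ⟨⟨toLPA E, toLPA_zero E⟩, toLPA_add E⟩ (toLPA_smul E)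

instance (E : DirGraph V A) : IsScalarTower K (LPA K E) (LPA K E) :=
  ⟨fun c x y => by
    obtain ⟨p, rfl⟩ := toLPA_surjective E x
    obtain ⟨q, rfl⟩ := toLPA_surjective E y
    simp only [smul_eq_mul, ← toLPA_smul, ← toLPA_mul, smul_mul_assoc]⟩

instance (E : DirGraph V A) : SMulCommClass K (LPA K E) (LPA K E) :=
  ⟨fun c x y => by
    obtain ⟨p, rfl⟩ := toLPA_surjective E x
    obtain ⟨q, rfl⟩ := toLPA_surjective E y
    simp only [smul_eq_mul, ← toLPA_smul, ← toLPA_mul, mul_smul_comm]⟩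

theorem toLPA_rel (E : DirGraph V A) {p q : FreeAlg K V A} (h : Rel K E p q) :
    toLPA E p = toLPA E q :=
  toLPA_eq E (RingConGen.Rel.of _ _ ⟨1, p, q, h, (one_smul _ _).symm, (one_smul _ _).symm⟩)

/-- The `K`-algebra homomorphism out of `L_K(E)` determined by images of the generators that
satisfy the defining relations. -/
noncomputable def LPA.lift (E : DirGraph V A) {S : Type*} [NonUnitalRing S] [Module K S]
    [IsScalarTower K S S] [SMulCommClass K S S] (F : Gen V A → S)
    (hF : ∀ p q, Rel K E p q →
      MonoidAlgebra.liftMagma K (FreeSemigroup.lift F) p =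
        MonoidAlgebra.liftMagma K (FreeSemigroup.lift F) q) :
    LPA K E →ₙₐ[K] S :=
  let Φ : FreeAlg K V A →ₙₐ[K] S := MonoidAlgebra.liftMagma K (FreeSemigroup.lift F)
  have key : ∀ p q, con K E p q → Φ p = Φ q := fun p q h => by
    have h' : RingConGen.Rel _ p q := h
    clear h
    induction h' with
    | of p q hpq =>
      obtain ⟨d, p', q', hr, rfl, rfl⟩ := hpq
      rw [map_smul, map_smul]; exact congrArg _ (hF _ _ hr)
    | refl x => rfl
    | symm _ ih => exact ih.symm
    | trans _ _ ih1 ih2 => exact ih1.trans ih2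
    | add _ _ ih1 ih2 => rw [map_add, map_add, ih1, ih2]
    | mul _ _ ih1 ih2 => rw [map_mul, map_mul, ih1, ih2]
  { toFun := fun x => Quotient.liftOn' x Φ key
    map_smul' := fun c x => by
      obtain ⟨p, rfl⟩ := toLPA_surjective E x
      exact map_smul Φ c p
    map_zero' := map_zero Φ
    map_add' := fun x y => by
      obtain ⟨p, rfl⟩ := toLPA_surjective E x
      obtain ⟨q, rfl⟩ := toLPA_surjective E y
      exact map_add Φ p q
    map_mul' := fun x y => by
      obtain ⟨p, rfl⟩ := toLPA_surjective E x
      obtain ⟨q, rfl⟩ := toLPA_surjective E y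
      exact map_mul Φ p q }

theorem LPA.lift_gen (E : DirGraph V A) {S : Type*} [NonUnitalRing S] [Module K S]
    [IsScalarTower K S S] [SMulCommClass K S S] (F : Gen V A → S) (hF) (t : Gen V A) :
    LPA.lift (K := K) E F hF (toLPA E (gen K t)) = F t := by
  change MonoidAlgebra.liftMagma K (FreeSemigroup.lift F) (gen K t) = F t
  simp [gen]

/-! ### The boundary path space and the partial action of the free group -/

/-- The set `X` of all infinite paths and all finite paths (vertices included) that end in a
sink. Such a path is given by the sequence of its edges and the sequence of the vertices it
visits: `edge n = some f` if its `(n+1)`-st edge is `f`, and `edge n = none` if it has at most `n`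
edges, in which case `vert n` is the sink in which it ends. A sink, as a path of length zero, has
no edges at all. -/
@[ext]
structure BoundaryPath (E : DirGraph V A) where
  vert : ℕ → V
  edge : ℕ → Option A
  step : ∀ n f, edge n = some f → E.src f = vert n ∧ E.rng f = vert (n + 1)
  sink_end : ∀ n, edge n = none → E.IsSink (vert n) ∧ vert (n + 1) = vert n

namespace BoundaryPath

variable {E : DirGraph V A}

/-- The source of a boundary path. -/
def source (ξ : E.BoundaryPath) : V := ξ.vert 0

/-- The path `ξ_{n+1} ξ_{n+2} ...`. -/
def drop (n : ℕ) (ξ : E.BoundaryPath) : E.BoundaryPath where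
  vert i := ξ.vert (n + i)
  edge i := ξ.edge (n + i)
  step i f h := ξ.step (n + i) f h
  sink_end i h := ξ.sink_end (n + i) h

/-- `ξ_1 ... ξ_{|a|} = a`. -/
def HasPrefix (a : List A) (ξ : E.BoundaryPath) : Prop :=
  ∀ i, i < a.length → ξ.edge i = a[i]?

/-- The path `fξ`. -/
def cons (f : A) (ξ : E.BoundaryPath) (h : E.rng f = ξ.source) : E.BoundaryPath where
  vert i := Nat.casesOn i (E.src f) ξ.vert
  edge i := Nat.casesOn i (some f) ξ.edge
  step i f' hf := by
    cases i with
    | zero => cases hf; exact ⟨rfl, h⟩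
    | succ i => exact ξ.step i f' hf
  sink_end i hi := by
    cases i with
    | zero => cases hi
    | succ i => exact ξ.sink_end i hi

theorem drop_drop (m n : ℕ) (ξ : E.BoundaryPath) : drop m (drop n ξ) = drop (n + m) ξ := by
  ext1 <;> funext i <;> simp [drop, add_assoc]

theorem drop_zero (ξ : E.BoundaryPath) : drop 0 ξ = ξ := by
  ext1 <;> funext i <;> simp [drop]

theorem hasPrefix_nil (ξ : E.BoundaryPath) : HasPrefix [] ξ := fun i h => by simp at h

theorem hasPrefix_append {a c : List A} {ξ : E.BoundaryPath} :
    HasPrefix (a ++ c) ξ ↔ HasPrefix a ξ ∧ HasPrefix c (drop a.length ξ) := by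
  constructor
  · intro h
    refine ⟨fun i hi => ?_, fun i hi => ?_⟩
    · rw [h i (by simp; omega), List.getElem?_append_left hi]
    · change ξ.edge (a.length + i) = _
      rw [h _ (by simp; omega), List.getElem?_append_right (by omega)]; simp
  · rintro ⟨h1, h2⟩ i hi
    by_cases hi' : i < a.length
    · rw [h1 i hi', List.getElem?_append_left hi']
    · have := h2 (i - a.length) (by simp at hi; omega)
      change ξ.edge (a.length + (i - a.length)) = _ at this
      rw [List.getElem?_append_right (by omega), ← this]; congr 1; omega

theorem hasPrefix_singleton {f : A} {ξ : E.BoundaryPath} :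
    HasPrefix [f] ξ ↔ ξ.edge 0 = some f := by
  constructor
  · intro h; simpa using h 0 (by simp)
  · intro h i hi
    obtain rfl : i = 0 := by simpa using hi
    simpa using h

/-- Two boundary paths with a common first edge and the same remainder are equal. -/
theorem eq_of_drop_one {ξ η : E.BoundaryPath} {f : A} (h1 : ξ.edge 0 = some f)
    (h2 : η.edge 0 = some f) (h : drop 1 ξ = drop 1 η) : ξ = η := by
  have hv := congrArg vert h
  have he := congrArg edge h
  ext1
  · funext i
    cases i with
    | zero => rw [← (ξ.step 0 f h1).1, ← (η.step 0 f h2).1]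
    | succ i => simpa [drop, add_comm] using congrFun hv i
  · funext i
    cases i with
    | zero => rw [h1, h2]
    | succ i => simpa [drop, add_comm] using congrFun he i

theorem eq_of_drop {a : List A} : ∀ {ξ η : E.BoundaryPath}, HasPrefix a ξ → HasPrefix a η →
    drop a.length ξ = drop a.length η → ξ = η := by
  induction a with
  | nil => intro ξ η _ _ h; simpa [drop_zero] using h
  | cons f a ih =>
    intro ξ η h1 h2 h
    rw [← List.singleton_append, hasPrefix_append] at h1 h2
    refine eq_of_drop_one (hasPrefix_singleton.1 h1.1) (hasPrefix_singleton.1 h2.1) ?_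
    refine ih h1.2 h2.2 ?_
    rw [drop_drop, drop_drop]; simpa [add_comm] using h

/-- Two prefixes of the same boundary path are comparable. -/
theorem prefix_total {a b : List A} {ξ : E.BoundaryPath} (h1 : HasPrefix a ξ)
    (h2 : HasPrefix b ξ) (h : a.length ≤ b.length) : ∃ c, b = a ++ c := by
  refine ⟨b.drop a.length, ?_⟩
  have : a = b.take a.length := by
    apply List.ext_getElem?
    intro i
    by_cases hi : i < a.length
    · rw [← h1 i hi, h2 i (by omega), List.getElem?_take_of_lt hi]
    · rw [List.getElem?_eq_none (by omega), List.getElem?_eq_none (by simp; omega)]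
  conv_rhs => rw [this]
  simp [List.take_append_drop, min_eq_left h]

end BoundaryPath

open BoundaryPath

/-- `b` is the empty word, or a path of nonzero length with range `x`. -/
def IsPathTo (E : DirGraph V A) (b : List A) (x : V) : Prop :=
  b.IsChain (fun f f' => E.rng f = E.src f') ∧ ∀ f ∈ b.getLast?, E.rng f = x

/-- The word `ab⁻¹` in the letters `f, f⁻¹`, for words `a, b` in the edges. -/
def word (a b : List A) : List (A × Bool) :=
  a.map (fun f => (f, true)) ++ (b.map (fun f => (f, false))).reverse

/-- `ab⁻¹` is the reduced form of `g`. -/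
def IsReducedForm (g : FreeGroup A) (a b : List A) : Prop :=
  g = FreeGroup.mk (word a b) ∧ FreeGroup.IsReduced (word a b)

/-- The set `X_g`. If `ab⁻¹` is the reduced form of `g`, where `a` and `b` are paths with
`r(a) = r(b)` if both are nonempty, it consists of the boundary paths that begin with `a`, if `a` is
nonempty, and of the boundary paths with source `r(b)`, if `a` is empty and `b` is not; it is `X` for
`g = 1`, and it is empty if `g` has no such reduced form. -/
def dom (E : DirGraph V A) (g : FreeGroup A) : Set E.BoundaryPath :=
  {ξ | ∃ a b, IsReducedForm g a b ∧ HasPrefix a ξ ∧ E.IsPathTo b (ξ.vert a.length)}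

/-- `ξ = θ_g(η)`: if `ab⁻¹` is the reduced form of `g`, then `η = bζ` and `ξ = aζ` for
some boundary path `ζ`. -/
def IsTheta (E : DirGraph V A) (g : FreeGroup A) (η ξ : E.BoundaryPath) : Prop :=
  ∃ a b, IsReducedForm g a b ∧ HasPrefix b η ∧ HasPrefix a ξ ∧ drop a.length ξ = drop b.length η

open Classical in
/-- The map `θ_g : X_{g⁻¹} → X_g` (with an irrelevant value outside `X_{g⁻¹}`). -/
noncomputable def theta (E : DirGraph V A) (g : FreeGroup A) (η : E.BoundaryPath) :
    E.BoundaryPath :=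
  if h : ∃ ξ, E.IsTheta g η ξ then h.choose else η

section PartialAction

variable {E : DirGraph V A}

/-- The positive element of the free group given by a word in the edges. -/
def pos (a : List A) : FreeGroup A := FreeGroup.mk (a.map fun f => (f, true))

theorem pos_append (a b : List A) : pos (a ++ b) = pos a * pos b := by
  simp [pos, FreeGroup.mul_mk]

theorem pos_singleton (f : A) : pos [f] = FreeGroup.of f := rfl

theorem pos_nil : pos ([] : List A) = 1 := rfl

theorem mk_word (a b : List A) : FreeGroup.mk (word a b) = pos a * (pos b)⁻¹ := by
  simp [word, pos, FreeGroup.inv_mk, FreeGroup.invRev, FreeGroup.mul_mk, Function.comp_def]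

theorem pos_injective : Function.Injective (pos : List A → FreeGroup A) := by
  intro a b h
  have hred : ∀ c : List A, FreeGroup.IsReduced (c.map fun f => (f, true)) := by
    intro c
    unfold FreeGroup.IsReduced
    rw [List.isChain_map]
    simp [List.isChain_iff_getElem]
  obtain ⟨L, h1, h2⟩ := FreeGroup.Red.exact.1 h
  rw [(hred a).red_iff_eq] at h1
  rw [(hred b).red_iff_eq] at h2
  exact List.map_injective_iff.2 (fun x y hxy => by simpa using hxy) (h1.symm.trans h2)

theorem isReduced_word {a b : List A} :
    FreeGroup.IsReduced (word a b) ↔ ∀ f, ¬ (f ∈ a.getLast? ∧ f ∈ b.getLast?) := by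
  unfold FreeGroup.IsReduced word
  rw [List.isChain_append, List.isChain_reverse, List.isChain_map, List.isChain_map]
  constructor
  · rintro ⟨-, -, h⟩ f ⟨h1, h2⟩
    have := h (f, true) (by simpa using h1) (f, false) (by simpa using h2) rfl
    simp at this
  · intro h
    refine ⟨by simp [List.isChain_iff_getElem], by simp [List.isChain_iff_getElem], ?_⟩
    rintro ⟨x, s⟩ hx ⟨y, t⟩ hy hxy
    simp at hx hy hxy
    obtain ⟨hx, rfl⟩ := hx
    obtain ⟨hy, rfl⟩ := hy
    subst hxy
    exact absurd ⟨hx, hy⟩ (h x)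

theorem isTheta_of (g : FreeGroup A) (η ξ : E.BoundaryPath) (a b : List A)
    (hg : g = pos a * (pos b)⁻¹) (hb : HasPrefix b η) (ha : HasPrefix a ξ)
    (hd : drop a.length ξ = drop b.length η) : E.IsTheta g η ξ := by
  induction a using List.reverseRecOn generalizing b with
  | nil =>
    exact ⟨[], b, ⟨by rw [mk_word, hg], isReduced_word.2 (by simp)⟩, hb, ha, hd⟩
  | append_singleton a f ih =>
    rcases List.eq_nil_or_concat' b with rfl | ⟨b', f', rfl⟩
    · exact ⟨_, _, ⟨by rw [mk_word, hg], isReduced_word.2 (by simp)⟩, hb, ha, hd⟩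
    · by_cases hf : f = f'
      · subst hf
        rw [hasPrefix_append] at ha hb
        refine ih b' ?_ hb.1 ha.1 ?_
        · rw [hg, pos_append, pos_append]; group
        · refine eq_of_drop_one (hasPrefix_singleton.1 ha.2) (hasPrefix_singleton.1 hb.2) ?_
          rw [drop_drop, drop_drop]; simpa using hd
      · refine ⟨_, _, ⟨by rw [mk_word, hg], isReduced_word.2 ?_⟩, hb, ha, hd⟩
        rintro x ⟨h1, h2⟩
        simp at h1 h2
        exact hf (h1.trans h2.symm)

theorem isTheta_iff {g : FreeGroup A} {η ξ : E.BoundaryPath} : E.IsTheta g η ξ ↔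
    ∃ a b, g = pos a * (pos b)⁻¹ ∧ HasPrefix b η ∧ HasPrefix a ξ ∧
      drop a.length ξ = drop b.length η := by
  constructor
  · rintro ⟨a, b, ⟨hg, -⟩, h⟩
    exact ⟨a, b, by rw [hg, mk_word], h⟩
  · rintro ⟨a, b, hg, h1, h2, h3⟩
    exact isTheta_of g η ξ a b hg h1 h2 h3

theorem isTheta_one {η ξ : E.BoundaryPath} (h : E.IsTheta 1 η ξ) : η = ξ := by
  obtain ⟨a, b, hg, hb, ha, hd⟩ := isTheta_iff.1 h
  obtain rfl : a = b := pos_injective (mul_inv_eq_one.1 hg.symm)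
  exact (eq_of_drop ha hb hd).symm

theorem isTheta_refl (ξ : E.BoundaryPath) : E.IsTheta 1 ξ ξ :=
  isTheta_iff.2 ⟨[], [], by simp [pos_nil], hasPrefix_nil _, hasPrefix_nil _, rfl⟩

theorem IsTheta.symm {g : FreeGroup A} {η ξ : E.BoundaryPath} (h : E.IsTheta g η ξ) :
    E.IsTheta g⁻¹ ξ η := by
  obtain ⟨a, b, hg, hb, ha, hd⟩ := isTheta_iff.1 h
  exact isTheta_iff.2 ⟨b, a, by rw [hg]; group, ha, hb, hd.symm⟩

theorem IsTheta.trans {g h : FreeGroup A} {ζ η ξ : E.BoundaryPath} (h1 : E.IsTheta g η ξ)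
    (h2 : E.IsTheta h ζ η) : E.IsTheta (g * h) ζ ξ := by
  obtain ⟨a, b, hg, hb, ha, hd⟩ := isTheta_iff.1 h1
  obtain ⟨a', b', hg', hb', ha', hd'⟩ := isTheta_iff.1 h2
  rcases le_total b.length a'.length with hl | hl
  · obtain ⟨c, rfl⟩ := prefix_total hb ha' hl
    rw [hasPrefix_append] at ha'
    refine isTheta_iff.2 ⟨a ++ c, b', ?_, hb', ?_, ?_⟩
    · rw [hg, hg', pos_append, pos_append]; group
    · rw [hasPrefix_append, hd]; exact ⟨ha, ha'.2⟩
    · rw [List.length_append, ← drop_drop, hd, drop_drop, ← hd', List.length_append]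
  · obtain ⟨c, rfl⟩ := prefix_total ha' hb hl
    rw [hasPrefix_append] at hb
    refine isTheta_iff.2 ⟨a, b' ++ c, ?_, ?_, ha, ?_⟩
    · rw [hg, hg', pos_append, pos_append]; group
    · rw [hasPrefix_append, ← hd']; exact ⟨hb', hb.2⟩
    · rw [hd, List.length_append, List.length_append, ← drop_drop, hd', drop_drop]

theorem IsTheta.unique {g : FreeGroup A} {η ξ ξ' : E.BoundaryPath} (h : E.IsTheta g η ξ)
    (h' : E.IsTheta g η ξ') : ξ = ξ' := by
  have := h'.trans h.symm
  rw [mul_inv_cancel] at this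
  exact isTheta_one this

theorem exists_concat (b : List A) (ζ : E.BoundaryPath) (h : E.IsPathTo b ζ.source) :
    ∃ η : E.BoundaryPath, HasPrefix b η ∧ drop b.length η = ζ := by
  induction b using List.reverseRecOn generalizing ζ with
  | nil => exact ⟨ζ, hasPrefix_nil _, drop_zero _⟩
  | append_singleton b f ih =>
    obtain ⟨hc, hl⟩ := h
    have hf : E.rng f = ζ.source := hl f (by simp)
    obtain ⟨η, h1, h2⟩ := ih (ζ.cons f hf) ⟨(List.isChain_append.1 hc).1, fun f' hf' =>
      (List.isChain_append.1 hc).2.2 f' hf' f (by simp)⟩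
    refine ⟨η, hasPrefix_append.2 ⟨h1, ?_⟩, ?_⟩
    · rw [h2, hasPrefix_singleton]; rfl
    · rw [List.length_append, ← drop_drop, h2]
      ext1 <;> funext i <;> simp [drop, cons, add_comm 1 i]

theorem isPathTo_of_hasPrefix {b : List A} {η : E.BoundaryPath} (h : HasPrefix b η) :
    E.IsPathTo b (η.vert b.length) := by
  induction b using List.reverseRecOn with
  | nil => exact ⟨List.isChain_nil, by simp⟩
  | append_singleton b f ih =>
    rw [hasPrefix_append, hasPrefix_singleton] at h
    have h2 := (η.step _ _ h.2)
    refine ⟨List.isChain_append.2 ⟨(ih h.1).1, by simp, ?_⟩, ?_⟩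
    · intro f' hf' f'' hf''
      obtain rfl : f = f'' := by simpa using hf''
      rw [(ih h.1).2 f' hf', h2.1]; rfl
    · intro f' hf'
      obtain rfl : f = f' := by simpa using hf'
      rw [h2.2]; simp

theorem mem_dom_iff {g : FreeGroup A} {ξ : E.BoundaryPath} :
    ξ ∈ E.dom g ↔ ∃ η, E.IsTheta g η ξ := by
  constructor
  · rintro ⟨a, b, hr, ha, hb⟩
    obtain ⟨η, h1, h2⟩ := exists_concat b (drop a.length ξ) (by simpa [source, drop] using hb)
    exact ⟨η, a, b, hr, h1, ha, h2.symm⟩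
  · rintro ⟨η, a, b, hr, hb, ha, hd⟩
    refine ⟨a, b, hr, ha, ?_⟩
    have := congrArg source hd
    simp only [source, drop, add_zero] at this
    rw [this]
    exact isPathTo_of_hasPrefix hb

theorem IsTheta.eq {g : FreeGroup A} {η ξ : E.BoundaryPath} (h : E.IsTheta g η ξ) :
    E.theta g η = ξ := by
  have h' : ∃ ξ, E.IsTheta g η ξ := ⟨ξ, h⟩
  rw [theta, dif_pos h']
  exact h'.choose_spec.unique h

theorem isTheta_theta {g : FreeGroup A} {ξ : E.BoundaryPath} (h : ξ ∈ E.dom g) :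
    E.IsTheta g (E.theta g⁻¹ ξ) ξ := by
  obtain ⟨η, hη⟩ := mem_dom_iff.1 h
  rwa [hη.symm.eq]

theorem isTheta_of_edge {f : A} {η ξ : E.BoundaryPath} :
    E.IsTheta (FreeGroup.of f) η ξ ↔ ξ.edge 0 = some f ∧ drop 1 ξ = η := by
  constructor
  · intro h
    obtain ⟨a, b, hg, hb, ha, hd⟩ := isTheta_iff.1 h
    obtain rfl : a = [f] ++ b := by
      apply pos_injective
      rw [pos_append, pos_singleton, hg]; group
    rw [hasPrefix_append] at ha
    refine ⟨hasPrefix_singleton.1 ha.1, eq_of_drop ha.2 hb ?_⟩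
    rw [← hd, List.length_append, drop_drop]; rfl
  · rintro ⟨h1, h2⟩
    exact isTheta_iff.2 ⟨[f], [], by simp [pos_nil, pos_singleton], hasPrefix_nil _,
      hasPrefix_singleton.2 h1, by simpa [drop_zero] using h2⟩

theorem mem_dom_of {f : A} {ξ : E.BoundaryPath} :
    ξ ∈ E.dom (FreeGroup.of f) ↔ ξ.edge 0 = some f := by
  rw [mem_dom_iff]
  simp [isTheta_of_edge]

theorem isTheta_of_inv {f : A} {η ξ : E.BoundaryPath} :
    E.IsTheta (FreeGroup.of f)⁻¹ η ξ ↔ η.edge 0 = some f ∧ drop 1 η = ξ := by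
  rw [← isTheta_of_edge]
  exact ⟨fun h => by simpa using h.symm, fun h => h.symm⟩

theorem mem_dom_of_inv {f : A} {ξ : E.BoundaryPath} :
    ξ ∈ E.dom (FreeGroup.of f)⁻¹ ↔ ξ.source = E.rng f := by
  rw [mem_dom_iff]
  constructor
  · rintro ⟨η, h⟩
    obtain ⟨h1, rfl⟩ := isTheta_of_inv.1 h
    simpa [source, drop] using (η.step 0 f h1).2.symm
  · intro h
    refine ⟨ξ.cons f h.symm, isTheta_of_inv.2 ⟨rfl, ?_⟩⟩
    ext1 <;> funext i <;> simp [drop, cons, add_comm 1 i]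

theorem mem_dom_one (ξ : E.BoundaryPath) : ξ ∈ E.dom 1 := mem_dom_iff.2 ⟨ξ, isTheta_refl ξ⟩

theorem mem_dom_pos {a : List A} {ξ : E.BoundaryPath} :
    ξ ∈ E.dom (pos a) ↔ HasPrefix a ξ := by
  rw [mem_dom_iff]
  constructor
  · rintro ⟨η, h⟩
    obtain ⟨a', b, hg, hb, ha, hd⟩ := isTheta_iff.1 h
    obtain rfl : a' = a ++ b := by
      apply pos_injective
      rw [pos_append, hg]; group
    exact (hasPrefix_append.1 ha).1
  · intro h
    exact ⟨_, isTheta_iff.2 ⟨a, [], by simp [pos_nil], hasPrefix_nil _, h, (drop_zero _).symm⟩⟩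

end PartialAction

/-! ### The partial skew group ring `D(X) ⋆ 𝔽` -/

section SkewRing

variable (K) (E : DirGraph V A)

/-- The characteristic function `1_g` of `X_g`. -/
noncomputable def oneG (g : FreeGroup A) : E.BoundaryPath → K := (E.dom g).indicator 1

/-- The characteristic function `1_x` of the set `X_x` of boundary paths with source `x`. -/
noncomputable def oneV (x : V) : E.BoundaryPath → K := {ξ | ξ.source = x}.indicator 1

/-- `D(X) = D_1`, the linear span of all `1_g`, `g ≠ 1`, and all `1_x`. -/
def DX : Submodule K (E.BoundaryPath → K) :=
  Submodule.span K ({φ | ∃ g : FreeGroup A, g ≠ 1 ∧ φ = oneG K E g} ∪ {φ | ∃ x, φ = oneV K E x})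

/-- The ideal `D_g = 1_g D(X)` of `D(X)`. -/
noncomputable def D (g : FreeGroup A) : Submodule K (E.BoundaryPath → K) :=
  (DX K E).map (LinearMap.mulLeft K (oneG K E g))

open Classical in
/-- `α_g(φ) = φ ∘ θ_{g⁻¹}` on `X_g`, extended by zero. -/
noncomputable def alpha (g : FreeGroup A) (φ : E.BoundaryPath → K) : E.BoundaryPath → K :=
  fun ξ => if ξ ∈ E.dom g then φ (E.theta g⁻¹ ξ) else 0

/-- The partial skew group ring `D(X) ⋆ 𝔽 = ⨁ D_g δ_g`, where `r δ_g` is the finitely supported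
function with value `r` at `g`. -/
noncomputable def Skew : Submodule K (FreeGroup A →₀ (E.BoundaryPath → K)) where
  carrier := {p | ∀ g, p g ∈ D K E g}
  add_mem' hp hq g := (D K E g).add_mem (hp g) (hq g)
  zero_mem' g := (D K E g).zero_mem
  smul_mem' c _ hp g := (D K E g).smul_mem c (hp g)

/-- The bi-additive extension of `(r δ_g) (r' δ_h) = α_g(α_{g⁻¹}(r) r') δ_{gh}`. -/
noncomputable def skewMul (p q : FreeGroup A →₀ (E.BoundaryPath → K)) :
    FreeGroup A →₀ (E.BoundaryPath → K) :=
  p.sum fun g r => q.sum fun h r' =>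
    Finsupp.single (g * h) (alpha K E g (alpha K E g⁻¹ r * r'))

variable {K E}

theorem alpha_add (g : FreeGroup A) (φ ψ : E.BoundaryPath → K) :
    alpha K E g (φ + ψ) = alpha K E g φ + alpha K E g ψ := by
  funext ξ; simp only [alpha, Pi.add_apply]; split_ifs <;> simp

theorem alpha_smul (g : FreeGroup A) (c : K) (φ : E.BoundaryPath → K) :
    alpha K E g (c • φ) = c • alpha K E g φ := by
  funext ξ; simp only [alpha, Pi.smul_apply]; split_ifs <;> simp

theorem alpha_zero (g : FreeGroup A) : alpha K E g (0 : E.BoundaryPath → K) = 0 := by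
  funext ξ; simp [alpha]

theorem alpha_apply_of {g : FreeGroup A} {η ξ : E.BoundaryPath} (h : E.IsTheta g η ξ)
    (φ : E.BoundaryPath → K) : alpha K E g φ ξ = φ η := by
  rw [alpha, if_pos (mem_dom_iff.2 ⟨η, h⟩), h.symm.eq]

theorem alpha_apply_not {g : FreeGroup A} {ξ : E.BoundaryPath} (h : ξ ∉ E.dom g)
    (φ : E.BoundaryPath → K) : alpha K E g φ ξ = 0 := by
  rw [alpha, if_neg h]

theorem alpha_one (φ : E.BoundaryPath → K) : alpha K E 1 φ = φ :=
  funext fun ξ => alpha_apply_of (isTheta_refl ξ) φ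

theorem mulCoeff (g : FreeGroup A) (r r' : E.BoundaryPath → K) :
    alpha K E g (alpha K E g⁻¹ r * r') = (E.dom g).indicator r * alpha K E g r' := by
  funext ξ
  by_cases h : ξ ∈ E.dom g
  · have h' := isTheta_theta h
    rw [alpha_apply_of h', Pi.mul_apply, Pi.mul_apply, alpha_apply_of h', alpha_apply_of h'.symm,
      Set.indicator_of_mem h]
  · rw [alpha_apply_not h, Pi.mul_apply, alpha_apply_not h, mul_zero]

theorem oneG_one : oneG K E 1 = 1 := by
  funext ξ; simp [oneG, mem_dom_one]

theorem dom_cases {g : FreeGroup A} (hg : g ≠ 1) : E.dom g = ∅ ∨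
    (∃ a, a ≠ [] ∧ E.dom g = {ξ | HasPrefix a ξ}) ∨ ∃ x, E.dom g = {ξ | ξ.source = x} := by
  rcases (E.dom g).eq_empty_or_nonempty with h | ⟨ξ₀, a, b, hr, ha, hb⟩
  · exact Or.inl h
  right
  have huniq : ∀ a' b', IsReducedForm g a' b' → a' = a ∧ b' = b := by
    intro a' b' hr'
    obtain ⟨L, h1, h2⟩ := FreeGroup.Red.exact.1 (hr'.1.symm.trans hr.1)
    rw [hr'.2.red_iff_eq] at h1
    rw [hr.2.red_iff_eq] at h2
    have hw := h1.symm.trans h2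
    have e1 := congrArg (fun l : List (A × Bool) => (l.filter (fun x => x.2)).map Prod.fst) hw
    have e2 := congrArg (fun l : List (A × Bool) => (l.filter (fun x => !x.2)).map Prod.fst) hw
    simp [word, List.filter_map, List.filter_reverse, Function.comp_def] at e1 e2
    exact ⟨e1, e2⟩
  by_cases hnil : a = []
  · right
    subst hnil
    have hbne : b ≠ [] := by
      rintro rfl
      exact hg (by rw [hr.1, mk_word]; simp [pos_nil])
    refine ⟨ξ₀.source, Set.ext fun ξ => ⟨?_, fun h => ?_⟩⟩
    · rintro ⟨a', b', hr', -, hb'⟩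
      obtain ⟨rfl, rfl⟩ := huniq _ _ hr'
      have h1 := hb.2 _ (List.getLast_mem_getLast? hbne)
      have h2 := hb'.2 _ (List.getLast_mem_getLast? hbne)
      exact h2.symm.trans h1
    · refine ⟨[], b, hr, hasPrefix_nil _, ?_⟩
      have h' : ξ.vert 0 = ξ₀.vert 0 := h
      simpa [h'] using hb
  · left
    refine ⟨a, hnil, Set.ext fun ξ => ⟨?_, fun h => ?_⟩⟩
    · rintro ⟨a', b', hr', ha', -⟩
      obtain ⟨rfl, rfl⟩ := huniq _ _ hr'
      exact ha'
    · refine ⟨a, b, hr, h, ?_⟩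
      have h1 := (isPathTo_of_hasPrefix ha).2 _ (List.getLast_mem_getLast? hnil)
      have h2 := (isPathTo_of_hasPrefix (show HasPrefix a ξ from h)).2 _
        (List.getLast_mem_getLast? hnil)
      rw [← h2, h1]; exact hb

theorem source_of_hasPrefix {a : List A} (ha : a ≠ []) {ξ ξ' : E.BoundaryPath}
    (h : HasPrefix a ξ) (h' : HasPrefix a ξ') : ξ.source = ξ'.source := by
  obtain ⟨f, a, rfl⟩ := List.exists_cons_of_ne_nil ha
  have h1 := (ξ.step 0 f (by simpa using h 0 (by simp))).1
  have h2 := (ξ'.step 0 f (by simpa using h' 0 (by simp))).1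
  exact h1.symm.trans h2

theorem source_of_dom {g : FreeGroup A} (hg : g ≠ 1) {ξ ξ' : E.BoundaryPath}
    (h : ξ ∈ E.dom g) (h' : ξ' ∈ E.dom g) : ξ.source = ξ'.source := by
  rcases dom_cases (E := E) hg with hd | ⟨a, ha, hd⟩ | ⟨x, hd⟩
  · rw [hd] at h; exact h.elim
  · rw [hd] at h h'; exact source_of_hasPrefix ha h h'
  · rw [hd] at h h'; exact h.trans h'.symm

theorem oneG_mem {g : FreeGroup A} (hg : g ≠ 1) : oneG K E g ∈ DX K E :=
  Submodule.subset_span (Or.inl ⟨g, hg, rfl⟩)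

theorem oneV_mem (x : V) : oneV K E x ∈ DX K E :=
  Submodule.subset_span (Or.inr ⟨x, rfl⟩)

theorem pos_ne_one {a : List A} (ha : a ≠ []) : pos a ≠ 1 := fun h =>
  ha (pos_injective (h.trans pos_nil.symm))

theorem indicator_prefix (a : List A) :
    ({ξ | HasPrefix a ξ}.indicator 1 : E.BoundaryPath → K) = oneG K E (pos a) := by
  unfold oneG
  congr 1
  ext ξ
  exact mem_dom_pos.symm

theorem gens_mul {φ ψ : E.BoundaryPath → K}
    (hφ : φ ∈ ({φ | ∃ g : FreeGroup A, g ≠ 1 ∧ φ = oneG K E g} ∪ {φ | ∃ x, φ = oneV K E x} :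
      Set (E.BoundaryPath → K)))
    (hψ : ψ ∈ ({φ | ∃ g : FreeGroup A, g ≠ 1 ∧ φ = oneG K E g} ∪ {φ | ∃ x, φ = oneV K E x} :
      Set (E.BoundaryPath → K))) : φ * ψ ∈ DX K E := by
  have key : ∀ φ : E.BoundaryPath → K,
      φ ∈ ({φ | ∃ g : FreeGroup A, g ≠ 1 ∧ φ = oneG K E g} ∪ {φ | ∃ x, φ = oneV K E x} :
        Set (E.BoundaryPath → K)) →
      φ = 0 ∨ (∃ a, a ≠ [] ∧ φ = {ξ | HasPrefix a ξ}.indicator 1) ∨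
        ∃ x, φ = {ξ | ξ.source = x}.indicator 1 := by
    rintro φ (⟨g, hg, rfl⟩ | ⟨x, rfl⟩)
    · rcases dom_cases (E := E) hg with hd | ⟨a, ha, hd⟩ | ⟨x, hd⟩
      · left; rw [oneG, hd, Set.indicator_empty]; rfl
      · right; left; exact ⟨a, ha, by rw [oneG, hd]⟩
      · right; right; exact ⟨x, by rw [oneG, hd]⟩
    · right; right; exact ⟨x, rfl⟩
  have hmul : ∀ S T : Set E.BoundaryPath,
      (S.indicator 1 * T.indicator 1 : E.BoundaryPath → K) = (S ∩ T).indicator 1 := by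
    intro S T
    funext ξ
    by_cases h1 : ξ ∈ S <;> by_cases h2 : ξ ∈ T <;> simp [h1, h2]
  have hpre : ∀ a : List A, a ≠ [] →
      ({ξ | HasPrefix a ξ}.indicator 1 : E.BoundaryPath → K) ∈ DX K E := fun a ha => by
    rw [indicator_prefix]; exact oneG_mem (pos_ne_one ha)
  have hzero : ∀ S : Set E.BoundaryPath, S = ∅ → (S.indicator 1 : E.BoundaryPath → K) ∈ DX K E := by
    rintro S rfl; rw [Set.indicator_empty]; exact (DX K E).zero_mem
  have hpv : ∀ (a : List A) (x : V), a ≠ [] →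
      (({ξ | HasPrefix a ξ} ∩ {ξ | ξ.source = x}).indicator 1 : E.BoundaryPath → K) ∈ DX K E := by
    intro a x ha
    rcases ({ξ | HasPrefix a ξ} ∩ {ξ : E.BoundaryPath | ξ.source = x}).eq_empty_or_nonempty with
      h | ⟨ξ₀, h1, h2⟩
    · exact hzero _ h
    · have hsub : {ξ | HasPrefix a ξ} ⊆ {ξ : E.BoundaryPath | ξ.source = x} :=
        fun ξ hξ => (source_of_hasPrefix ha hξ h1).trans h2
      rw [Set.inter_eq_left.2 hsub]
      exact hpre a ha
  rcases key φ hφ with rfl | ⟨a, ha, rfl⟩ | ⟨x, rfl⟩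
  · rw [zero_mul]; exact (DX K E).zero_mem
  · rcases key ψ hψ with rfl | ⟨b, hb, rfl⟩ | ⟨y, rfl⟩
    · rw [mul_zero]; exact (DX K E).zero_mem
    · rw [hmul]
      rcases ({ξ | HasPrefix a ξ} ∩ {ξ : E.BoundaryPath | HasPrefix b ξ}).eq_empty_or_nonempty with
        h | ⟨ξ₀, h1, h2⟩
      · exact hzero _ h
      · rcases le_total a.length b.length with hl | hl
        · obtain ⟨c, rfl⟩ := prefix_total h1 h2 hl
          have hsub : {ξ | HasPrefix (a ++ c) ξ} ⊆ {ξ : E.BoundaryPath | HasPrefix a ξ} :=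
            fun ξ hξ => (hasPrefix_append.1 hξ).1
          rw [Set.inter_eq_right.2 hsub]
          exact hpre _ hb
        · obtain ⟨c, rfl⟩ := prefix_total h2 h1 hl
          have hsub : {ξ | HasPrefix (b ++ c) ξ} ⊆ {ξ : E.BoundaryPath | HasPrefix b ξ} :=
            fun ξ hξ => (hasPrefix_append.1 hξ).1
          rw [Set.inter_eq_left.2 hsub]
          exact hpre _ ha
    · rw [hmul]; exact hpv a y ha
  · rcases key ψ hψ with rfl | ⟨b, hb, rfl⟩ | ⟨y, rfl⟩
    · rw [mul_zero]; exact (DX K E).zero_mem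
    · rw [mul_comm, hmul]; exact hpv b x hb
    · rw [hmul]
      rcases eq_or_ne x y with rfl | hxy
      · rw [Set.inter_self]; exact oneV_mem x
      · exact hzero _ (Set.eq_empty_of_forall_notMem fun ξ hξ => hxy (hξ.1.symm.trans hξ.2))

theorem DX_mul {φ ψ : E.BoundaryPath → K} (hφ : φ ∈ DX K E) (hψ : ψ ∈ DX K E) :
    φ * ψ ∈ DX K E := by
  have h : DX K E * DX K E ≤ DX K E := by
    conv_lhs => rw [DX, Submodule.span_mul_span]
    rw [Submodule.span_le]
    rintro _ ⟨φ, hφ, ψ, hψ, rfl⟩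
    exact gens_mul hφ hψ
  exact h (Submodule.mul_mem_mul hφ hψ)

theorem oneG_mul_mem (g : FreeGroup A) {φ : E.BoundaryPath → K} (hφ : φ ∈ DX K E) :
    oneG K E g * φ ∈ DX K E := by
  rcases eq_or_ne g 1 with rfl | hg
  · rwa [oneG_one, one_mul]
  · exact DX_mul (oneG_mem hg) hφ

theorem DX_of_D {g : FreeGroup A} {φ : E.BoundaryPath → K} (hφ : φ ∈ D K E g) : φ ∈ DX K E := by
  obtain ⟨ψ, hψ, rfl⟩ := hφ
  exact oneG_mul_mem g hψ

theorem mem_D {g : FreeGroup A} {φ : E.BoundaryPath → K} (hφ : φ ∈ DX K E) :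
    oneG K E g * φ ∈ D K E g := ⟨φ, hφ, rfl⟩

theorem D_support {g : FreeGroup A} {φ : E.BoundaryPath → K} (hφ : φ ∈ D K E g)
    {ξ : E.BoundaryPath} (hξ : ξ ∉ E.dom g) : φ ξ = 0 := by
  obtain ⟨ψ, hψ, rfl⟩ := hφ
  simp [oneG, hξ]

theorem D_indicator {g : FreeGroup A} {φ : E.BoundaryPath → K} (hφ : φ ∈ D K E g) :
    (E.dom g).indicator φ = φ :=
  Set.indicator_eq_self.2 fun ξ hξ => by
    by_contra h
    exact hξ (D_support hφ h)

theorem alpha_oneG (g k : FreeGroup A) :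
    alpha K E g (oneG K E k) = oneG K E g * oneG K E (g * k) := by
  funext ξ
  by_cases h : ξ ∈ E.dom g
  · have h' := isTheta_theta h
    rw [alpha_apply_of h', Pi.mul_apply]
    have : E.theta g⁻¹ ξ ∈ E.dom k ↔ ξ ∈ E.dom (g * k) := by
      rw [mem_dom_iff, mem_dom_iff]
      constructor
      · rintro ⟨ζ, hζ⟩; exact ⟨ζ, h'.trans hζ⟩
      · rintro ⟨ζ, hζ⟩; exact ⟨ζ, by simpa using h'.symm.trans hζ⟩
    by_cases hk : E.theta g⁻¹ ξ ∈ E.dom k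
    · simp [oneG, h, hk, this.1 hk]
    · have hk' : ξ ∉ E.dom (g * k) := fun hc => hk (this.2 hc)
      simp [oneG, hk, hk']
  · rw [alpha_apply_not h]; simp [oneG, h]

theorem alpha_mem (g : FreeGroup A) {φ : E.BoundaryPath → K} (hφ : φ ∈ DX K E) :
    alpha K E g φ ∈ DX K E := by
  rcases eq_or_ne g 1 with rfl | hg
  · rwa [alpha_one]
  induction hφ using Submodule.span_induction with
  | mem φ h =>
    rcases h with ⟨k, hk, rfl⟩ | ⟨x, rfl⟩
    · rw [alpha_oneG, mul_comm]
      exact oneG_mul_mem _ (oneG_mem hg)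
    · by_cases h : ∃ ξ ∈ E.dom g, (E.theta g⁻¹ ξ).source = x
      · obtain ⟨ξ₀, h0, rfl⟩ := h
        have : alpha K E g (oneV K E (E.theta g⁻¹ ξ₀).source) = oneG K E g := by
          funext ξ
          by_cases h : ξ ∈ E.dom g
          · have h' := isTheta_theta h
            rw [alpha_apply_of h']
            have : (E.theta g⁻¹ ξ).source = (E.theta g⁻¹ ξ₀).source :=
              source_of_dom (inv_ne_one.2 hg) (mem_dom_iff.2 ⟨_, h'.symm⟩)
                (mem_dom_iff.2 ⟨_, (isTheta_theta h0).symm⟩)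
            simp [oneV, oneG, h, this]
          · rw [alpha_apply_not h]; simp [oneG, h]
        rw [this]; exact oneG_mem hg
      · have : alpha K E g (oneV K E x) = 0 := by
          funext ξ
          by_cases h1 : ξ ∈ E.dom g
          · rw [alpha_apply_of (isTheta_theta h1)]
            have h2 : (E.theta g⁻¹ ξ).source ≠ x := fun hc => h ⟨ξ, h1, hc⟩
            simp [oneV, h2]
          · exact alpha_apply_not h1 _
        rw [this]; exact (DX K E).zero_mem
  | zero => rw [alpha_zero]; exact (DX K E).zero_mem
  | add φ ψ _ _ h1 h2 => rw [alpha_add]; exact (DX K E).add_mem h1 h2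
  | smul c φ _ h => rw [alpha_smul]; exact (DX K E).smul_mem c h

theorem mulCoeff_mem {g h : FreeGroup A} {r r' : E.BoundaryPath → K} (hr : r ∈ D K E g)
    (hr' : r' ∈ D K E h) : alpha K E g (alpha K E g⁻¹ r * r') ∈ D K E (g * h) := by
  have : alpha K E g (alpha K E g⁻¹ r * r') = oneG K E (g * h) * (r * alpha K E g r') := by
    rw [mulCoeff, D_indicator hr]
    funext ξ
    by_cases hgh : ξ ∈ E.dom (g * h)
    · simp [oneG, hgh]
    · by_cases hg : ξ ∈ E.dom g
      · have h' := isTheta_theta hg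
        have : E.theta g⁻¹ ξ ∉ E.dom h := fun hc => by
          obtain ⟨ζ, hζ⟩ := mem_dom_iff.1 hc
          exact hgh (mem_dom_iff.2 ⟨ζ, h'.trans hζ⟩)
        simp [oneG, hgh, alpha_apply_of h', D_support hr' this]
      · simp [oneG, hgh, alpha_apply_not hg]
  rw [this]
  exact mem_D (DX_mul (DX_of_D hr) (alpha_mem g (DX_of_D hr')))

theorem skewMul_mem {p q : FreeGroup A →₀ (E.BoundaryPath → K)} (hp : p ∈ Skew K E)
    (hq : q ∈ Skew K E) : skewMul K E p q ∈ Skew K E := by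
  refine Submodule.sum_mem _ fun g _ => Submodule.sum_mem _ fun h _ => fun k => ?_
  classical
  rw [Finsupp.single_apply]
  split_ifs with e
  · rw [← e]; exact mulCoeff_mem (hp g) (hq h)
  · exact Submodule.zero_mem _

theorem mulCoeff_zero_left (g : FreeGroup A) (r' : E.BoundaryPath → K) :
    alpha K E g (alpha K E g⁻¹ 0 * r') = 0 := by rw [alpha_zero, zero_mul, alpha_zero]

theorem mulCoeff_zero_right (g : FreeGroup A) (r : E.BoundaryPath → K) :
    alpha K E g (alpha K E g⁻¹ r * 0) = 0 := by rw [mul_zero, alpha_zero]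

theorem skewMul_add (p q q' : FreeGroup A →₀ (E.BoundaryPath → K)) :
    skewMul K E p (q + q') = skewMul K E p q + skewMul K E p q' := by
  classical
  unfold skewMul
  rw [← Finsupp.sum_add]
  refine Finsupp.sum_congr fun g _ => ?_
  rw [Finsupp.sum_add_index']
  · intro h; rw [mulCoeff_zero_right, Finsupp.single_zero]
  · intro h r r'; rw [mul_add, alpha_add, Finsupp.single_add]

theorem skewMul_add_left (p p' q : FreeGroup A →₀ (E.BoundaryPath → K)) :
    skewMul K E (p + p') q = skewMul K E p q + skewMul K E p' q := by
  classical
  unfold skewMul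
  rw [Finsupp.sum_add_index']
  · intro h; simp only [mulCoeff_zero_left, Finsupp.single_zero, Finsupp.sum_fun_zero]
  · intro h r r'
    rw [← Finsupp.sum_add]
    refine Finsupp.sum_congr fun g _ => ?_
    rw [alpha_add, add_mul, alpha_add, Finsupp.single_add]

theorem skewMul_single (g h : FreeGroup A) (r r' : E.BoundaryPath → K) :
    skewMul K E (Finsupp.single g r) (Finsupp.single h r') =
      Finsupp.single (g * h) (alpha K E g (alpha K E g⁻¹ r * r')) := by
  unfold skewMul
  rw [Finsupp.sum_single_index, Finsupp.sum_single_index]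
  · rw [mulCoeff_zero_right, Finsupp.single_zero]
  · simp only [mulCoeff_zero_left, Finsupp.single_zero, Finsupp.sum_fun_zero]

theorem skewMul_zero (p : FreeGroup A →₀ (E.BoundaryPath → K)) : skewMul K E p 0 = 0 := by
  have := skewMul_add p 0 0
  simpa using this

theorem zero_skewMul (p : FreeGroup A →₀ (E.BoundaryPath → K)) : skewMul K E 0 p = 0 := by
  have := skewMul_add_left 0 0 p
  simpa using this

/-- Every element of `D(X) ⋆ 𝔽` is a sum of elements `r δ_g` with `r ∈ D_g`. -/
theorem skew_induction {P : (FreeGroup A →₀ (E.BoundaryPath → K)) → Prop}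
    {p : FreeGroup A →₀ (E.BoundaryPath → K)} (hp : p ∈ Skew K E) (h0 : P 0)
    (hadd : ∀ p q, P p → P q → P (p + q))
    (hs : ∀ g r, r ∈ D K E g → P (Finsupp.single g r)) : P p := by
  rw [← Finsupp.sum_single p]
  exact Finset.sum_induction _ P hadd h0 fun g _ => hs g _ (hp g)

theorem skewMul_assoc {p q s : FreeGroup A →₀ (E.BoundaryPath → K)} (hp : p ∈ Skew K E)
    (hq : q ∈ Skew K E) (hs : s ∈ Skew K E) :
    skewMul K E (skewMul K E p q) s = skewMul K E p (skewMul K E q s) := by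
  refine skew_induction (P := fun p => skewMul K E (skewMul K E p q) s =
    skewMul K E p (skewMul K E q s)) hp (by simp only [zero_skewMul])
    (fun _ _ h1 h2 => by simp only [skewMul_add_left, h1, h2]) fun g r hr => ?_
  refine skew_induction (P := fun q => skewMul K E (skewMul K E (.single g r) q) s =
    skewMul K E (.single g r) (skewMul K E q s)) hq (by simp only [zero_skewMul, skewMul_zero])
    (fun _ _ h1 h2 => by simp only [skewMul_add_left, skewMul_add, h1, h2]) fun h r' hr' => ?_
  refine skew_induction (P := fun s => skewMul K E (skewMul K E (.single g r) (.single h r')) s =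
    skewMul K E (.single g r) (skewMul K E (.single h r') s)) hs (by simp only [skewMul_zero])
    (fun _ _ h1 h2 => by simp only [skewMul_add, h1, h2]) fun k r'' hr'' => ?_
  rw [skewMul_single, skewMul_single, skewMul_single, skewMul_single, mul_assoc]
  congr 1
  have hgh := mulCoeff_mem hr hr'
  rw [mulCoeff (g * h), D_indicator hgh, mulCoeff, mulCoeff, mulCoeff, D_indicator hr,
    D_indicator hr', mul_assoc]
  congr 1
  funext ξ
  by_cases hg : ξ ∈ E.dom g
  · have h' := isTheta_theta hg
    rw [Pi.mul_apply, alpha_apply_of h', alpha_apply_of h', Pi.mul_apply]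
    by_cases hh : E.theta g⁻¹ ξ ∈ E.dom h
    · have h'' := isTheta_theta hh
      rw [alpha_apply_of h'', alpha_apply_of (h'.trans h'')]
    · rw [D_support hr' hh, zero_mul, zero_mul]
  · rw [Pi.mul_apply, alpha_apply_not hg, alpha_apply_not hg, zero_mul]

theorem skewMul_smul (c : K) (p q : FreeGroup A →₀ (E.BoundaryPath → K)) :
    skewMul K E p (c • q) = c • skewMul K E p q := by
  induction p using Finsupp.induction_linear with
  | zero => simp only [zero_skewMul, smul_zero]
  | add p p' h h' => simp only [skewMul_add_left, h, h', smul_add]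
  | single g r =>
    induction q using Finsupp.induction_linear with
    | zero => simp only [skewMul_zero, smul_zero]
    | add p p' h h' => simp only [skewMul_add, h, h', smul_add]
    | single h r' =>
      rw [Finsupp.smul_single, skewMul_single, skewMul_single, Finsupp.smul_single, mul_smul_comm,
        alpha_smul]

theorem smul_skewMul (c : K) (p q : FreeGroup A →₀ (E.BoundaryPath → K)) :
    skewMul K E (c • p) q = c • skewMul K E p q := by
  induction p using Finsupp.induction_linear with
  | zero => simp only [zero_skewMul, smul_zero]
  | add p p' h h' => simp only [skewMul_add_left, h, h', smul_add]
  | single g r =>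
    induction q using Finsupp.induction_linear with
    | zero => simp only [skewMul_zero, smul_zero]
    | add p p' h h' => simp only [skewMul_add, h, h', smul_add]
    | single h r' =>
      rw [Finsupp.smul_single, skewMul_single, skewMul_single, Finsupp.smul_single, alpha_smul,
        smul_mul_assoc, alpha_smul]

noncomputable instance : NonUnitalRing (Skew K E) where
  mul p q := ⟨skewMul K E p q, skewMul_mem p.2 q.2⟩
  left_distrib p q s := Subtype.ext (skewMul_add p.1 q.1 s.1)
  right_distrib p q s := Subtype.ext (skewMul_add_left p.1 q.1 s.1)
  zero_mul p := Subtype.ext (zero_skewMul p.1)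
  mul_zero p := Subtype.ext (skewMul_zero p.1)
  mul_assoc p q s := Subtype.ext (skewMul_assoc p.2 q.2 s.2)

theorem skew_coe_mul (p q : Skew K E) : (p * q : Skew K E).1 = skewMul K E p.1 q.1 := rfl

instance : IsScalarTower K (Skew K E) (Skew K E) :=
  ⟨fun c p q => Subtype.ext (smul_skewMul c p.1 q.1)⟩

instance : SMulCommClass K (Skew K E) (Skew K E) :=
  ⟨fun c p q => Subtype.ext (skewMul_smul c p.1 q.1).symm⟩

theorem oneG_mem_D (g : FreeGroup A) (hg : g ≠ 1) : oneG K E g ∈ D K E g := by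
  have := mem_D (g := g) (oneG_mem (K := K) (E := E) hg)
  have h2 : oneG K E g * oneG K E g = oneG K E g := by
    funext ξ; by_cases h : ξ ∈ E.dom g <;> simp [oneG, h]
  rwa [h2] at this

theorem oneV_mem_D (x : V) : oneV K E x ∈ D K E 1 := by
  have := mem_D (g := 1) (oneV_mem (K := K) (E := E) x)
  rwa [oneG_one, one_mul] at this

variable (K E)

/-- The element `r δ_g`, for `r ∈ D_g`. -/
noncomputable def delta (g : FreeGroup A) (r : E.BoundaryPath → K) (hr : r ∈ D K E g) :
    Skew K E :=
  ⟨Finsupp.single g r, fun k => by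
    classical
    rw [Finsupp.single_apply]
    split_ifs with e
    · rwa [← e]
    · exact Submodule.zero_mem _⟩

/-- The values of the isomorphism on the generators: `x ↦ 1_x δ_1`, `f ↦ 1_f δ_f`,
`f* ↦ 1_{f⁻¹} δ_{f⁻¹}`. -/
noncomputable def phiGen : Gen V A → Skew K E
  | .vert x => delta K E 1 (oneV K E x) (oneV_mem_D x)
  | .edge f => delta K E (FreeGroup.of f) (oneG K E (FreeGroup.of f))
      (oneG_mem_D _ (FreeGroup.of_ne_one f))
  | .ghost f => delta K E (FreeGroup.of f)⁻¹ (oneG K E (FreeGroup.of f)⁻¹)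
      (oneG_mem_D _ (inv_ne_one.2 (FreeGroup.of_ne_one f)))

end SkewRing

/-! ### The isomorphism `φ : L_K(E) → D(X) ⋆ 𝔽` and the induced grading -/

section Phi

variable {E : DirGraph V A}

theorem delta_mul (g h : FreeGroup A) (r r' : E.BoundaryPath → K) (hr : r ∈ D K E g)
    (hr' : r' ∈ D K E h) : (delta K E g r hr * delta K E h r' hr').1 =
      Finsupp.single (g * h) (r * alpha K E g r') := by
  rw [skew_coe_mul]
  change skewMul K E (Finsupp.single g r) (Finsupp.single h r') = _
  rw [skewMul_single, mulCoeff, D_indicator hr]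

theorem oneG_mul_self (g : FreeGroup A) : oneG K E g * oneG K E g = oneG K E g := by
  funext ξ; by_cases h : ξ ∈ E.dom g <;> simp [oneG, h]

theorem oneG_inv_of (f : A) : oneG K E (FreeGroup.of f)⁻¹ = oneV K E (E.rng f) := by
  unfold oneG oneV
  congr 1
  ext ξ
  exact mem_dom_of_inv

theorem liftMagma_gen {S : Type*} [NonUnitalRing S] [Module K S]
    [IsScalarTower K S S] [SMulCommClass K S S] (F : Gen V A → S) (t : Gen V A) :
    MonoidAlgebra.liftMagma K (FreeSemigroup.lift F) (gen K t) = F t := by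
  simp [gen]

theorem phiGen_rel (p q : FreeAlg K V A) (h : Rel K E p q) :
    MonoidAlgebra.liftMagma K (FreeSemigroup.lift (phiGen K E)) p =
      MonoidAlgebra.liftMagma K (FreeSemigroup.lift (phiGen K E)) q := by
  induction h with
  | idem x =>
    simp only [map_mul, liftMagma_gen, phiGen]
    refine Subtype.ext ?_
    rw [delta_mul, alpha_one, mul_one]
    change _ = Finsupp.single _ _
    congr 1
    funext ξ; by_cases h : ξ.source = x <;> simp [oneV, h]
  | orth x y hxy =>
    simp only [map_mul, liftMagma_gen, phiGen, map_zero]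
    refine Subtype.ext ?_
    rw [delta_mul, alpha_one, mul_one]
    change _ = (0 : FreeGroup A →₀ (E.BoundaryPath → K))
    rw [Finsupp.single_eq_zero]
    funext ξ
    by_cases h : ξ.source = x
    · simp [oneV, h, hxy]
    · simp [oneV, h]
  | src_edge f =>
    simp only [map_mul, liftMagma_gen, phiGen]
    refine Subtype.ext ?_
    rw [delta_mul, alpha_one, one_mul]
    change _ = Finsupp.single _ _
    congr 1
    funext ξ
    by_cases h : ξ ∈ E.dom (FreeGroup.of f)
    · have := (ξ.step 0 f (mem_dom_of.1 h)).1
      simp [oneV, oneG, h, source, this]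
    · simp [oneG, h]
  | edge_rng f =>
    simp only [map_mul, liftMagma_gen, phiGen]
    refine Subtype.ext ?_
    rw [delta_mul, mul_one, ← oneG_inv_of, alpha_oneG, mul_inv_cancel, oneG_one, mul_one,
      oneG_mul_self]
    rfl
  | rng_ghost f =>
    simp only [map_mul, liftMagma_gen, phiGen]
    refine Subtype.ext ?_
    rw [delta_mul, one_mul, ← oneG_inv_of, alpha_one, oneG_mul_self]
    rfl
  | ghost_src f =>
    simp only [map_mul, liftMagma_gen, phiGen]
    refine Subtype.ext ?_
    rw [delta_mul, mul_one]
    change _ = Finsupp.single _ _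
    congr 1
    funext ξ
    by_cases h : ξ ∈ E.dom (FreeGroup.of f)⁻¹
    · have h' := isTheta_theta h
      rw [Pi.mul_apply, alpha_apply_of h']
      have h1 := (isTheta_of_inv.1 h').1
      have h2 := (BoundaryPath.step _ 0 f h1).1
      simp only [inv_inv] at h2
      simp [oneV, oneG, h, source, h2]
    · simp [oneG, h]
  | ghost_edge_same f =>
    simp only [map_mul, liftMagma_gen, phiGen]
    refine Subtype.ext ?_
    rw [delta_mul, alpha_oneG, inv_mul_cancel, oneG_one, mul_one, oneG_mul_self, oneG_inv_of]
    rfl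
  | ghost_edge_ne f f' hf =>
    simp only [map_mul, liftMagma_gen, phiGen, map_zero]
    refine Subtype.ext ?_
    rw [delta_mul]
    change _ = (0 : FreeGroup A →₀ (E.BoundaryPath → K))
    rw [Finsupp.single_eq_zero]
    funext ξ
    by_cases h : ξ ∈ E.dom (FreeGroup.of f)⁻¹
    · have h' := isTheta_theta h
      rw [Pi.mul_apply, alpha_apply_of h']
      have h1 := (isTheta_of_inv.1 h').1
      have h2 : E.theta (FreeGroup.of f)⁻¹⁻¹ ξ ∉ E.dom (FreeGroup.of f') := fun hc => by
        rw [mem_dom_of, h1] at hc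
        exact hf (Option.some.inj hc)
      rw [oneG, oneG, Set.indicator_of_notMem h2, mul_zero]; rfl
    · simp [oneG, h]
  | sum_eq x hfin hne =>
    simp only [map_sum, map_mul, liftMagma_gen, phiGen]
    refine Subtype.ext ?_
    rw [Submodule.coe_sum]
    simp only [delta_mul, alpha_oneG, mul_inv_cancel, oneG_one, mul_one, oneG_mul_self]
    change Finsupp.single _ _ = _
    rw [← Finsupp.single_finsetSum]
    congr 1
    funext ξ
    rw [Finset.sum_apply]
    by_cases h : ξ.source = x
    · cases hξ : ξ.edge 0 with
      | none =>
        obtain ⟨f, hf⟩ := hne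
        exact absurd (hf.trans h.symm) ((ξ.sink_end 0 hξ).1 f)
      | some f =>
        have hs : E.src f = x := (ξ.step 0 f hξ).1.trans h
        rw [Finset.sum_eq_single f]
        · simp [oneV, oneG, h, mem_dom_of, hξ]
        · intro f' _ hf'
          have : ξ ∉ E.dom (FreeGroup.of f') := fun hc => by
            rw [mem_dom_of, hξ] at hc
            exact hf' (Option.some.inj hc).symm
          simp [oneG, this]
        · intro hc; exact absurd (by simpa using hs) hc
    · rw [Finset.sum_eq_zero]
      · simp [oneV, h]
      · intro f hf
        have hf' : E.src f = x := by simpa using hf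
        have : ξ ∉ E.dom (FreeGroup.of f) := fun hc =>
          h ((ξ.step 0 f (mem_dom_of.1 hc)).1.symm.trans hf')
        simp [oneG, this]

variable (K E) in
/-- The homomorphism `φ : L_K(E) → D(X) ⋆ 𝔽` with `φ(x) = 1_x δ_1`, `φ(f) = 1_f δ_f` and
`φ(f*) = 1_{f⁻¹} δ_{f⁻¹}`. -/
noncomputable def phi : LPA K E →ₙₐ[K] Skew K E := LPA.lift E (phiGen K E) phiGen_rel

theorem phi_gen (t : Gen V A) : phi K E (toLPA E (gen K t)) = phiGen K E t :=
  LPA.lift_gen E _ _ t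

variable (K E) in
/-- The subgroup `D_g δ_g` of `D(X) ⋆ 𝔽`. -/
def component (g : FreeGroup A) : AddSubgroup (Skew K E) where
  carrier := {p | ∀ h, h ≠ g → p.1 h = 0}
  add_mem' hp hq h hh := by simp [hp h hh, hq h hh]
  zero_mem' h _ := rfl
  neg_mem' hp h hh := by simp [hp h hh]

variable (K E) in
/-- The grading of `L_K(E)` by the free group on the edges that is induced by `φ`:
`L_K(E)_g = φ⁻¹(D_g δ_g)`. -/
noncomputable def grading (g : FreeGroup A) : AddSubgroup (LPA K E) :=
  (component K E g).comap (phi K E : LPA K E →+ Skew K E)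

end Phi

/-! ### `φ` is injective, and the family `L_K(E)_g` is a grading -/

section Injective

variable {E : DirGraph V A}

variable (K E) in
/-- A vertex, as an element of `L_K(E)`. -/
noncomputable def vx (x : V) : LPA K E := toLPA E (gen K (.vert x))

variable (K E) in
/-- An edge, as an element of `L_K(E)`. -/
noncomputable def ed (f : A) : LPA K E := toLPA E (gen K (.edge f))

variable (K E) in
/-- A ghost edge, as an element of `L_K(E)`. -/
noncomputable def gh (f : A) : LPA K E := toLPA E (gen K (.ghost f))

theorem LPA.induction {P : LPA K E → Prop} (hv : ∀ x, P (vx K E x)) (he : ∀ f, P (ed K E f))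
    (hg : ∀ f, P (gh K E f)) (h0 : P 0) (hadd : ∀ y z, P y → P z → P (y + z))
    (hsmul : ∀ (c : K) y, P y → P (c • y)) (hmul : ∀ y z, P y → P z → P (y * z))
    (y : LPA K E) : P y := by
  obtain ⟨p, rfl⟩ := toLPA_surjective E y
  induction p using MonoidAlgebra.induction_linear with
  | zero => exact h0
  | add p q hp hq => exact hadd _ _ hp hq
  | single w c =>
    have key : P (toLPA E (MonoidAlgebra.single w 1)) := by
      induction w using FreeSemigroup.recOnMul with
      | ih1 t => cases t with
        | vert x => exact hv x
        | edge f => exact he f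
        | ghost f => exact hg f
      | ih2 t w ht hw =>
        have := hmul _ _ ht hw
        rwa [← toLPA_mul, MonoidAlgebra.single_mul_single, mul_one] at this
    have := hsmul c _ key
    rwa [← toLPA_smul, MonoidAlgebra.smul_single, smul_eq_mul, mul_one] at this

theorem vx_mul_self (x : V) : vx K E x * vx K E x = vx K E x := toLPA_rel E (.idem x)
theorem vx_mul_ne {x y : V} (h : x ≠ y) : vx K E x * vx K E y = 0 := toLPA_rel E (.orth x y h)
theorem vx_ed (f : A) : vx K E (E.src f) * ed K E f = ed K E f := toLPA_rel E (.src_edge f)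
theorem ed_vx (f : A) : ed K E f * vx K E (E.rng f) = ed K E f := toLPA_rel E (.edge_rng f)
theorem vx_gh (f : A) : vx K E (E.rng f) * gh K E f = gh K E f := toLPA_rel E (.rng_ghost f)
theorem gh_vx (f : A) : gh K E f * vx K E (E.src f) = gh K E f := toLPA_rel E (.ghost_src f)
theorem gh_ed (f : A) : gh K E f * ed K E f = vx K E (E.rng f) := toLPA_rel E (.ghost_edge_same f)
theorem gh_ed_ne {f f' : A} (h : f ≠ f') : gh K E f * ed K E f' = 0 :=
  toLPA_rel E (.ghost_edge_ne f f' h)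

theorem vx_ed_ne {x : V} {f : A} (h : x ≠ E.src f) : vx K E x * ed K E f = 0 := by
  rw [← vx_ed, ← mul_assoc, vx_mul_ne h, zero_mul]
theorem ed_vx_ne {x : V} {f : A} (h : E.rng f ≠ x) : ed K E f * vx K E x = 0 := by
  rw [← ed_vx, mul_assoc, vx_mul_ne h, mul_zero]
theorem gh_vx_ne {x : V} {f : A} (h : E.src f ≠ x) : gh K E f * vx K E x = 0 := by
  rw [← gh_vx, mul_assoc, vx_mul_ne h, mul_zero]

theorem vx_eq_sum (x : V) (hfin : {f | E.src f = x}.Finite) (hne : {f | E.src f = x}.Nonempty) :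
    vx K E x = ∑ f ∈ hfin.toFinset, ed K E f * gh K E f := by
  have h := toLPA_rel (K := K) E (.sum_eq x hfin hne)
  let q : FreeAlg K V A →+ LPA K E := ⟨⟨toLPA E, toLPA_zero E⟩, toLPA_add E⟩
  change q _ = q _ at h
  rw [map_sum] at h
  exact h

/-- Left multiplication by a word in the edges. -/
noncomputable def lft (a : List A) (z : LPA K E) : LPA K E := a.foldr (fun f z => ed K E f * z) z

/-- Right multiplication by `b*`. -/
noncomputable def rgt (b : List A) (z : LPA K E) : LPA K E := b.foldr (fun f z => z * gh K E f) z

variable (K E) in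
/-- The monomial `a x b*`. -/
noncomputable def mon (a : List A) (x : V) (b : List A) : LPA K E := lft a (rgt b (vx K E x))

theorem lft_mul (a : List A) (z y : LPA K E) : lft a (z * y) = lft a z * y := by
  induction a with
  | nil => rfl
  | cons f a ih => simp only [lft, List.foldr_cons] at ih ⊢; rw [ih, mul_assoc]

theorem lft_zero (a : List A) : lft a (0 : LPA K E) = 0 := by
  have := lft_mul a (0 : LPA K E) 0
  simpa using this

theorem mul_rgt (b : List A) (z y : LPA K E) : rgt b (z * y) = z * rgt b y := by
  induction b with
  | nil => rfl
  | cons f a ih => simp only [rgt, List.foldr_cons] at ih ⊢; rw [ih, mul_assoc]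

theorem rgt_zero (b : List A) : rgt b (0 : LPA K E) = 0 := by
  have := mul_rgt b (0 : LPA K E) 0
  simpa using this

theorem mon_cons (f : A) (a : List A) (x : V) (b : List A) :
    mon K E (f :: a) x b = ed K E f * mon K E a x b := rfl

theorem mon_ghost (a : List A) (x : V) (f : A) (b : List A) :
    mon K E a x (f :: b) = mon K E a x b * gh K E f := by
  rw [mon, mon, ← lft_mul]; rfl

theorem vx_mon (y : V) (a : List A) (x : V) (b : List A) :
    vx K E y * mon K E a x b = 0 ∨ vx K E y * mon K E a x b = mon K E a x b := by
  cases a with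
  | nil =>
    change vx K E y * rgt b _ = _ ∨ vx K E y * rgt b _ = rgt b _
    rw [← mul_rgt]
    rcases eq_or_ne y x with rfl | h
    · right; rw [vx_mul_self]
    · left; rw [vx_mul_ne h, rgt_zero]
  | cons f a =>
    rw [mon_cons, ← mul_assoc]
    rcases eq_or_ne y (E.src f) with rfl | h
    · right; rw [vx_ed]
    · left; rw [vx_ed_ne h, zero_mul]

/-- A vertex that fixes the monomial on the right. -/
def monSrc (E : DirGraph V A) (x : V) : List A → V
  | [] => x
  | f :: _ => E.src f

theorem mon_vx (a : List A) (x : V) (b : List A) :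
    mon K E a x b * vx K E (E.monSrc x b) = mon K E a x b := by
  cases b with
  | nil => change lft a (vx K E x) * vx K E x = lft a (vx K E x); rw [← lft_mul, vx_mul_self]
  | cons f b => rw [mon_ghost, mul_assoc]; simp only [monSrc]; rw [gh_vx]

theorem mon_vx_ne (a : List A) (x : V) (b : List A) {y : V} (h : E.monSrc x b ≠ y) :
    mon K E a x b * vx K E y = 0 := by
  rw [← mon_vx, mul_assoc, vx_mul_ne h, mul_zero]

variable (K E) in
/-- The span of the monomials `a x b*` with `|b| ≤ n`. -/
noncomputable def Sn (n : ℕ) : Submodule K (LPA K E) :=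
  Submodule.span K {z | ∃ a x b, b.length ≤ n ∧ z = mon K E a x b}

theorem mon_mem_Sn {n : ℕ} {a : List A} {x : V} {b : List A} (h : b.length ≤ n) :
    mon K E a x b ∈ Sn K E n := Submodule.subset_span ⟨a, x, b, h, rfl⟩

theorem mon_mem_span (y : LPA K E) :
    y ∈ Submodule.span K {z | ∃ a x b, z = mon K E a x b} := by
  set T := Submodule.span K {z | ∃ a x b, z = mon K E a x b} with hT
  have hmon : ∀ a x b, mon K E a x b ∈ T := fun a x b => Submodule.subset_span ⟨a, x, b, rfl⟩
  have hvm : ∀ y a x b, vx K E y * mon K E a x b ∈ T := fun y a x b => by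
    rcases vx_mon (K := K) (E := E) y a x b with h | h <;> rw [h]
    · exact T.zero_mem
    · exact hmon _ _ _
  have lin : ∀ t : LPA K E, (∀ a x b, t * mon K E a x b ∈ T) → ∀ z ∈ T, t * z ∈ T := by
    intro t ht z hz
    induction hz using Submodule.span_induction with
    | mem z h => obtain ⟨a, x, b, rfl⟩ := h; exact ht a x b
    | zero => rw [mul_zero]; exact T.zero_mem
    | add _ _ _ _ h1 h2 => rw [mul_add]; exact T.add_mem h1 h2
    | smul c _ _ h => rw [mul_smul_comm]; exact T.smul_mem c h
  have main : y ∈ T ∧ ∀ z ∈ T, y * z ∈ T := by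
    refine LPA.induction (P := fun y => y ∈ T ∧ ∀ z ∈ T, y * z ∈ T) (fun x => ⟨hmon [] x [], ?_⟩)
      (fun f => ⟨?_, ?_⟩) (fun f => ⟨?_, ?_⟩) ⟨T.zero_mem, fun z _ => ?_⟩ (fun y y' h h' =>
      ⟨T.add_mem h.1 h'.1, fun z hz => ?_⟩) (fun c y h => ⟨T.smul_mem c h.1, fun z hz => ?_⟩)
      (fun y y' h h' => ⟨h.2 _ h'.1, fun z hz => ?_⟩) y
    · exact lin _ (hvm x)
    · rw [← ed_vx]; exact hmon [f] (E.rng f) []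
    · exact lin _ fun a x b => hmon (f :: a) x b
    · rw [← vx_gh]; exact hmon [] (E.rng f) [f]
    · refine lin _ fun a x b => ?_
      cases a with
      | nil =>
        change gh K E f * rgt b _ ∈ T
        rw [← mul_rgt]
        rcases eq_or_ne (E.src f) x with rfl | h
        · rw [gh_vx, ← vx_gh]
          have : mon K E [] (E.rng f) (b ++ [f]) = rgt b (vx K E (E.rng f) * gh K E f) := by
            simp [mon, lft, rgt]
          rw [← this]; exact hmon _ _ _
        · rw [gh_vx_ne h, rgt_zero]; exact T.zero_mem
      | cons f' a =>
        rw [mon_cons, ← mul_assoc]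
        rcases eq_or_ne f f' with rfl | h
        · rw [gh_ed]; exact hvm _ _ _ _
        · rw [gh_ed_ne h, zero_mul]; exact T.zero_mem
    · rw [zero_mul]; exact T.zero_mem
    · rw [add_mul]; exact T.add_mem (h.2 z hz) (h'.2 z hz)
    · rw [smul_mul_assoc]; exact T.smul_mem c (h.2 z hz)
    · rw [mul_assoc]; exact h.2 _ (h'.2 z hz)
  exact main.1

theorem mem_Sn (y : LPA K E) : ∃ n, y ∈ Sn K E n := by
  have hmono : ∀ {m n : ℕ}, m ≤ n → Sn K E m ≤ Sn K E n := fun h => Submodule.span_mono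
    fun z ⟨a, x, b, hb, hz⟩ => ⟨a, x, b, hb.trans h, hz⟩
  induction mon_mem_span y using Submodule.span_induction with
  | mem z h => obtain ⟨a, x, b, rfl⟩ := h; exact ⟨_, mon_mem_Sn le_rfl⟩
  | zero => exact ⟨0, Submodule.zero_mem _⟩
  | add _ _ _ _ h1 h2 =>
    obtain ⟨m, hm⟩ := h1
    obtain ⟨n, hn⟩ := h2
    exact ⟨max m n, Submodule.add_mem _ (hmono (le_max_left _ _) hm) (hmono (le_max_right _ _) hn)⟩
  | smul c _ _ h => obtain ⟨n, hn⟩ := h; exact ⟨n, Submodule.smul_mem _ c hn⟩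

theorem eq_zero_of_mul_vx {y : LPA K E} (h : ∀ x, y * vx K E x = 0) : y = 0 := by
  classical
  have key : ∃ F : Finset V, ∀ G : Finset V, F ⊆ G → ∑ x ∈ G, y * vx K E x = y := by
    clear h
    induction mon_mem_span y using Submodule.span_induction with
    | mem z h =>
      obtain ⟨a, x, b, rfl⟩ := h
      refine ⟨{E.monSrc x b}, fun G hG => ?_⟩
      rw [Finset.sum_eq_single (E.monSrc x b), mon_vx]
      · intro y _ hy; exact mon_vx_ne _ _ _ hy.symm
      · intro hc; exact absurd (hG (by simp)) hc
    | zero => exact ⟨∅, fun G _ => by simp⟩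
    | add y z _ _ h1 h2 =>
      obtain ⟨F, hF⟩ := h1
      obtain ⟨F', hF'⟩ := h2
      refine ⟨F ∪ F', fun G hG => ?_⟩
      simp only [add_mul, Finset.sum_add_distrib]
      rw [hF G (Finset.union_subset_left hG), hF' G (Finset.union_subset_right hG)]
    | smul c y _ h =>
      obtain ⟨F, hF⟩ := h
      refine ⟨F, fun G hG => ?_⟩
      simp only [smul_mul_assoc, ← Finset.smul_sum]
      rw [hF G hG]
  obtain ⟨F, hF⟩ := key
  rw [← hF F subset_rfl]
  exact Finset.sum_eq_zero fun x _ => h x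

theorem Sn_mul_ed {n : ℕ} {y : LPA K E} (hy : y ∈ Sn K E (n + 1)) (f : A) :
    y * ed K E f ∈ Sn K E n := by
  induction hy using Submodule.span_induction with
  | mem z h =>
    obtain ⟨a, x, b, hb, rfl⟩ := h
    cases b with
    | nil =>
      change lft a (vx K E x) * ed K E f ∈ _
      rw [← lft_mul]
      rcases eq_or_ne x (E.src f) with rfl | h
      · rw [vx_ed, ← ed_vx]
        have : mon K E (a ++ [f]) (E.rng f) [] = lft a (ed K E f * vx K E (E.rng f)) := by
          simp [mon, lft, rgt]
        rw [← this]; exact mon_mem_Sn (by simp)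
      · rw [vx_ed_ne h, lft_zero]; exact Submodule.zero_mem _
    | cons f' b =>
      rw [mon_ghost, mul_assoc]
      rcases eq_or_ne f' f with rfl | h
      · rw [gh_ed]
        rcases eq_or_ne (E.monSrc x b) (E.rng f') with h | h
        · rw [← h, mon_vx]; exact mon_mem_Sn (by simpa using hb)
        · rw [mon_vx_ne _ _ _ h]; exact Submodule.zero_mem _
      · rw [gh_ed_ne h, mul_zero]; exact Submodule.zero_mem _
  | zero => rw [zero_mul]; exact Submodule.zero_mem _
  | add _ _ _ _ h1 h2 => rw [add_mul]; exact Submodule.add_mem _ h1 h2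
  | smul c _ _ h => rw [smul_mul_assoc]; exact Submodule.smul_mem _ c h

/-- Every vertex is the source of a boundary path. -/
theorem exists_boundaryPath (E : DirGraph V A) (x : V) : ∃ ζ : E.BoundaryPath, ζ.source = x := by
  classical
  let nxt : V → V := fun y => if h : ∃ f, E.src f = y then E.rng h.choose else y
  refine ⟨⟨fun n => nxt^[n] x,
    fun n => if h : ∃ f, E.src f = nxt^[n] x then some h.choose else none, ?_, ?_⟩, rfl⟩
  · intro n f hf
    split_ifs at hf with h
    · cases hf
      refine ⟨h.choose_spec, ?_⟩
      rw [Function.iterate_succ_apply']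
      simp only [nxt]
      rw [dif_pos h]
  · intro n hf
    split_ifs at hf with h
    refine ⟨fun f hc => h ⟨f, hc⟩, ?_⟩
    rw [Function.iterate_succ_apply']
    simp only [nxt]
    rw [dif_neg h]

theorem phi_vx (x : V) : phi K E (vx K E x) = delta K E 1 (oneV K E x) (oneV_mem_D x) := phi_gen _

theorem phi_ed (f : A) : phi K E (ed K E f) = delta K E (FreeGroup.of f)
    (oneG K E (FreeGroup.of f)) (oneG_mem_D _ (FreeGroup.of_ne_one f)) := phi_gen _

theorem phi_gh (f : A) : phi K E (gh K E f) = delta K E (FreeGroup.of f)⁻¹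
    (oneG K E (FreeGroup.of f)⁻¹) (oneG_mem_D _ (inv_ne_one.2 (FreeGroup.of_ne_one f))) := phi_gen _

theorem phi_mon (a : List A) (x : V) : (phi K E (mon K E a x [])).1 =
    Finsupp.single (pos a) ({ξ | HasPrefix a ξ ∧ ξ.vert a.length = x}.indicator 1) := by
  classical
  induction a with
  | nil =>
    change (phi K E (vx K E x)).1 = _
    rw [phi_vx]
    change Finsupp.single _ _ = _
    rw [pos_nil]
    congr 1
    unfold oneV
    congr 1
    ext ξ
    simp [hasPrefix_nil, source]
  | cons f a ih =>
    rw [mon_cons, map_mul, phi_ed, skew_coe_mul, ih]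
    change skewMul K E (Finsupp.single _ _) _ = _
    rw [skewMul_single, mulCoeff, D_indicator (oneG_mem_D _ (FreeGroup.of_ne_one f)),
      ← List.singleton_append, pos_append, pos_singleton]
    congr 1
    funext ξ
    by_cases h : ξ ∈ E.dom (FreeGroup.of f)
    · have h1 := mem_dom_of.1 h
      rw [Pi.mul_apply, alpha_apply_of (isTheta_of_edge.2 ⟨h1, rfl⟩)]
      simp only [oneG, Set.indicator_apply, h, if_true, Set.mem_ofPred_eq, hasPrefix_append,
        hasPrefix_singleton, h1, true_and, one_mul, Pi.one_apply, List.length_append,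
        List.length_singleton]
      rfl
    · have h1 : ¬ ξ.edge 0 = some f := fun hc => h (mem_dom_of.2 hc)
      rw [Pi.mul_apply, alpha_apply_not h, mul_zero, Set.indicator_of_notMem]
      rintro ⟨hc, -⟩
      exact h1 (hasPrefix_singleton.1 (hasPrefix_append.1 hc).1)

theorem mon_eq_zero (a : List A) (x : V) (h : ¬ E.IsPathTo a x) : mon K E a x [] = 0 := by
  induction a with
  | nil => exact absurd ⟨List.isChain_nil, by simp⟩ h
  | cons f a ih =>
    rw [mon_cons]
    cases a with
    | nil =>
      refine ed_vx_ne fun hc => h ⟨List.isChain_singleton _, ?_⟩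
      intro f' hf'
      obtain rfl : f = f' := by simpa using hf'
      exact hc
    | cons f' a =>
      by_cases ha : E.IsPathTo (f' :: a) x
      · rw [mon_cons, ← mul_assoc]
        have : E.rng f ≠ E.src f' := fun hc =>
          h ⟨List.isChain_cons_cons.2 ⟨hc, ha.1⟩, by
            rw [List.getLast?_cons_cons]; exact ha.2⟩
        rw [← vx_ed f', ← mul_assoc, ed_vx_ne this, zero_mul, zero_mul]
      · rw [ih ha, mul_zero]

theorem eq_zero_of_phi_mul {x : V} {y : LPA K E}
    (hy : y ∈ Submodule.span K (Set.range fun a => mon K E a x []))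
    {h : FreeGroup A} {r : E.BoundaryPath → K} (hr : r ∈ D K E h) {ζ : E.BoundaryPath}
    (hζ : ζ.source = x) (hrζ : r ζ ≠ 0) (h0 : phi K E y * delta K E h r hr = 0) : y = 0 := by
  classical
  obtain ⟨c, rfl⟩ := Finsupp.mem_span_range_iff_exists_finsupp.1 hy
  refine Finset.sum_eq_zero fun a₀ _ => ?_
  by_cases hp : E.IsPathTo a₀ x
  · obtain ⟨ξ, hξ, hd⟩ := exists_concat a₀ ζ (by rwa [hζ])
    have hv : ξ.vert a₀.length = x := by
      rw [← hζ, ← hd]; simp [source, drop]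
    have hth : E.IsTheta (pos a₀) ζ ξ :=
      isTheta_iff.2 ⟨a₀, [], by simp [pos_nil], hasPrefix_nil _, hξ, by rw [hd]; exact
        (drop_zero _).symm⟩
    have e : (phi K E (c.sum fun a t => t • mon K E a x []) * delta K E h r hr).1 =
        c.sum fun a t => Finsupp.single (pos a * h)
          (t • ({ξ | HasPrefix a ξ ∧ ξ.vert a.length = x}.indicator 1 * alpha K E (pos a) r)) := by
      rw [Finsupp.sum, map_sum, Finset.sum_mul, Submodule.coe_sum]
      refine Finset.sum_congr rfl fun a _ => ?_
      rw [map_smul, smul_mul_assoc, Submodule.coe_smul, skew_coe_mul, phi_mon]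
      change _ • skewMul K E _ (Finsupp.single _ _) = _
      rw [skewMul_single, mulCoeff, Finsupp.smul_single, Set.indicator_eq_self.2]
      intro ξ hξ
      exact mem_dom_pos.2 (Set.mem_of_indicator_ne_zero hξ).1
    rw [h0] at e
    have e' := congrFun (DFunLike.congr_fun e (pos a₀ * h)) ξ
    rw [Finsupp.sum, Finsupp.finsetSum_apply, Finset.sum_apply, Finset.sum_eq_single a₀] at e'
    · rw [Finsupp.single_eq_same, Pi.smul_apply, Pi.mul_apply, alpha_apply_of hth,
        Set.indicator_of_mem (show ξ ∈ {ξ | HasPrefix a₀ ξ ∧ ξ.vert a₀.length = x} from ⟨hξ, hv⟩)]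
        at e'
      have : c a₀ = 0 := by
        have e'' : 0 = c a₀ * (1 * r ζ) := e'
        simpa [hrζ] using e''.symm
      simp [this]
    · intro a _ ha
      rw [Finsupp.single_eq_of_ne]
      · rfl
      · intro hc
        exact ha (pos_injective (mul_right_cancel hc)).symm
    · intro hc
      rw [Finsupp.notMem_support_iff.1 hc]; simp
  · change c a₀ • mon K E a₀ x [] = 0
    rw [mon_eq_zero a₀ x hp, smul_zero]

theorem decomp (x : V) (y : LPA K E) :
    ∃ u ∈ Submodule.span K (Set.range fun a => mon K E a x []), ∃ z : A →₀ LPA K E,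
      (∀ f, E.src f ≠ x → z f = 0) ∧ y * vx K E x = u + z.sum fun f t => t * gh K E f := by
  classical
  induction mon_mem_span y using Submodule.span_induction with
  | mem y h =>
    obtain ⟨a, w, b, rfl⟩ := h
    rcases eq_or_ne (E.monSrc w b) x with h | h
    · subst h
      rw [mon_vx]
      cases b with
      | nil => exact ⟨_, Submodule.subset_span ⟨a, rfl⟩, 0, fun _ _ => rfl, by simp [monSrc]⟩
      | cons f b =>
        refine ⟨0, Submodule.zero_mem _, Finsupp.single f (mon K E a w b), fun f' hf' => ?_, ?_⟩
        · rw [Finsupp.single_eq_of_ne]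
          rintro rfl
          exact hf' rfl
        · rw [Finsupp.sum_single_index (zero_mul _), zero_add, mon_ghost]
    · exact ⟨0, Submodule.zero_mem _, 0, fun _ _ => rfl, by rw [mon_vx_ne _ _ _ h]; simp⟩
  | zero => exact ⟨0, Submodule.zero_mem _, 0, fun _ _ => rfl, by simp⟩
  | add y y' _ _ h h' =>
    obtain ⟨u, hu, z, hz, e⟩ := h
    obtain ⟨u', hu', z', hz', e'⟩ := h'
    refine ⟨u + u', Submodule.add_mem _ hu hu', z + z', fun f hf => ?_, ?_⟩
    · simp [hz f hf, hz' f hf]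
    · rw [Finsupp.sum_add_index' (fun _ => zero_mul _) (fun _ _ _ => add_mul _ _ _), add_mul, e, e']
      abel
  | smul c y _ h =>
    obtain ⟨u, hu, z, hz, e⟩ := h
    refine ⟨c • u, Submodule.smul_mem _ c hu, c • z, fun f hf => ?_, ?_⟩
    · simp [hz f hf]
    · rw [Finsupp.sum_smul_index' (fun _ => zero_mul _), smul_mul_assoc, e, smul_add,
        Finsupp.smul_sum]
      simp only [smul_mul_assoc]

theorem oneV_apply {x : V} {ζ : E.BoundaryPath} (h : ζ.source = x) : oneV K E x ζ ≠ 0 := by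
  simp [oneV, h]

theorem phi_injective_aux (n : ℕ) :
    ∀ y ∈ Sn K E n, phi K E y = 0 → y = 0 := by
  classical
  induction n with
  | zero =>
    intro y hy h0
    refine eq_zero_of_mul_vx fun x => ?_
    obtain ⟨ζ, hζ⟩ := exists_boundaryPath E x
    refine eq_zero_of_phi_mul (x := x) ?_ (oneV_mem_D x) hζ (oneV_apply hζ)
      (by rw [map_mul, h0, zero_mul, zero_mul])
    clear h0
    induction hy using Submodule.span_induction with
    | mem z h =>
      obtain ⟨a, w, b, hb, rfl⟩ := h
      obtain rfl : b = [] := by simpa using hb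
      rcases eq_or_ne w x with rfl | h
      · have := mon_vx (K := K) (E := E) a w []
        simp only [monSrc] at this
        rw [this]; exact Submodule.subset_span ⟨a, rfl⟩
      · rw [mon_vx_ne a w [] h]; exact Submodule.zero_mem _
    | zero => rw [zero_mul]; exact Submodule.zero_mem _
    | add _ _ _ _ h1 h2 => rw [add_mul]; exact Submodule.add_mem _ h1 h2
    | smul c _ _ h => rw [smul_mul_assoc]; exact Submodule.smul_mem _ c h
  | succ n ih =>
    intro y hy h0
    have hye : ∀ f, y * ed K E f = 0 := fun f =>
      ih _ (Sn_mul_ed hy f) (by rw [map_mul, h0, zero_mul])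
    refine eq_zero_of_mul_vx fun x => ?_
    obtain ⟨u, hu, z, hz, e⟩ := decomp x y
    have hmul : ∀ f, E.src f = x → y * ed K E f = u * ed K E f + z f * vx K E (E.rng f) := by
      intro f hf
      have : y * ed K E f = y * vx K E x * ed K E f := by rw [mul_assoc, ← hf, vx_ed]
      rw [this, e, add_mul, Finsupp.sum_mul, Finsupp.sum, Finset.sum_eq_single f]
      · rw [mul_assoc, gh_ed]
      · intro f' _ hf'
        rw [mul_assoc, gh_ed_ne hf', mul_zero]
      · intro hc
        rw [Finsupp.notMem_support_iff.1 hc, zero_mul, zero_mul]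
    by_cases hnew : ∃ f, E.src f = x ∧ z f = 0
    · obtain ⟨f, hf, hzf⟩ := hnew
      have hu0 : u = 0 := by
        obtain ⟨ζ, hζ⟩ := exists_boundaryPath E (E.rng f)
        have hedge : (ζ.cons f hζ.symm) ∈ E.dom (FreeGroup.of f) := mem_dom_of.2 rfl
        refine eq_zero_of_phi_mul hu (oneG_mem_D _ (FreeGroup.of_ne_one f))
          (ζ := ζ.cons f hζ.symm) hf (by simp [oneG, hedge]) ?_
        rw [← phi_ed, ← map_mul]
        have := hmul f hf
        rw [hzf, zero_mul, add_zero] at this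
        rw [← this, hye, map_zero]
      rw [e, hu0, zero_add]
      refine Finset.sum_eq_zero fun f' hf' => ?_
      have hs : E.src f' = x := by
        by_contra hc
        exact (Finsupp.mem_support_iff.1 hf') (hz f' hc)
      have h1 := hmul f' hs
      rw [hye, hu0, zero_mul, zero_add] at h1
      change z f' * gh K E f' = 0
      rw [← vx_gh, ← mul_assoc, ← h1, zero_mul]
    · push Not at hnew
      have hfin : {f | E.src f = x}.Finite :=
        z.support.finite_toSet.subset fun f hf => Finsupp.mem_support_iff.2 (hnew f hf)
      rcases {f | E.src f = x}.eq_empty_or_nonempty with hemp | hne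
      · have hz0 : z = 0 := by
          ext1 f
          refine hz f fun hc => ?_
          have : f ∈ {f | E.src f = x} := hc
          rw [hemp] at this; exact this
        rw [hz0, Finsupp.sum_zero_index, add_zero] at e
        obtain ⟨ζ, hζ⟩ := exists_boundaryPath E x
        rw [e]
        refine eq_zero_of_phi_mul hu (oneV_mem_D x) hζ (oneV_apply hζ) ?_
        rw [← e, map_mul, h0, zero_mul, zero_mul]
      · rw [vx_eq_sum x hfin hne, Finset.mul_sum]
        refine Finset.sum_eq_zero fun f _ => ?_
        rw [← mul_assoc, hye, zero_mul]

theorem phi_injective : Function.Injective (phi K E) := by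
  intro y z h
  rw [← sub_eq_zero]
  obtain ⟨n, hn⟩ := mem_Sn (y - z)
  exact phi_injective_aux n _ hn (by rw [map_sub, h, sub_self])

end Injective

section IsGrading

variable {E : DirGraph V A}

theorem mem_grading {g : FreeGroup A} {y : LPA K E} :
    y ∈ grading K E g ↔ ∀ h, h ≠ g → (phi K E y).1 h = 0 := Iff.rfl

theorem delta_mem_component (g : FreeGroup A) (r : E.BoundaryPath → K) (hr : r ∈ D K E g) :
    delta K E g r hr ∈ component K E g := fun _ hh => Finsupp.single_eq_of_ne hh

theorem component_eq {g : FreeGroup A} {p : Skew K E} (hp : p ∈ component K E g) :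
    p = delta K E g (p.1 g) (p.2 g) := by
  refine Subtype.ext (Finsupp.ext fun h => ?_)
  rcases eq_or_ne h g with rfl | hh
  · exact Finsupp.single_eq_same.symm
  · rw [hp h hh]; exact (Finsupp.single_eq_of_ne hh).symm

theorem grading_mul_mem {g h : FreeGroup A} {y z : LPA K E} (hy : y ∈ grading K E g)
    (hz : z ∈ grading K E h) : y * z ∈ grading K E (g * h) := by
  change phi K E (y * z) ∈ component K E (g * h)
  rw [map_mul, component_eq (show phi K E y ∈ component K E g from hy),
    component_eq (show phi K E z ∈ component K E h from hz)]
  intro k hk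
  rw [delta_mul]
  exact Finsupp.single_eq_of_ne hk

theorem grading_isInternal [DecidableEq (FreeGroup A)] :
    DirectSum.IsInternal (grading K E) := by
  have _ : DecidableEq (LPA K E) := Classical.decEq _
  constructor
  · rw [injective_iff_map_eq_zero]
    intro y hy
    refine DFinsupp.ext fun g => Subtype.ext (phi_injective ?_)
    have e : phi K E (DirectSum.coeAddMonoidHom (grading K E) y) = 0 := by
        rw [hy, map_zero]
    rw [DirectSum.coeAddMonoidHom_eq_dfinsuppSum, DFinsupp.sum, map_sum] at e
    have e' := DFunLike.congr_fun (congrArg Subtype.val e) g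
    rw [Submodule.coe_sum, Finsupp.finsetSum_apply, Finset.sum_eq_single g] at e'
    · refine Subtype.ext (Finsupp.ext fun h => ?_)
      rcases eq_or_ne h g with rfl | hh
      · rw [e']; simp
      · exact ((y g).2 h hh).trans (by simp)
    · intro h _ hh
      exact (y h).2 g hh.symm
    · intro hc
      rw [DFinsupp.notMem_support_iff.1 hc]
      simp
  · intro y
    change y ∈ (DirectSum.coeAddMonoidHom (grading K E)).range
    have hof : ∀ {g : FreeGroup A} {y : LPA K E}, y ∈ grading K E g →
        y ∈ (DirectSum.coeAddMonoidHom (grading K E)).range := fun {g y} hy =>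
      ⟨DirectSum.of (fun g => grading K E g) g ⟨y, hy⟩, DirectSum.coeAddMonoidHom_of _ _ _⟩
    have hind : ∀ (P : LPA K E → Prop), (∀ g, ∀ y ∈ grading K E g, P y) → P 0 →
        (∀ y z, P y → P z → P (y + z)) →
        ∀ y ∈ (DirectSum.coeAddMonoidHom (grading K E)).range, P y := by
      rintro P h1 h0 h2 _ ⟨t, rfl⟩
      induction t using DirectSum.induction_on with
      | zero => rw [map_zero]; exact h0
      | of g t => rw [DirectSum.coeAddMonoidHom_of]; exact h1 g _ t.2
      | add t t' h h' => rw [map_add]; exact h2 _ _ h h'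
    refine LPA.induction
      (P := fun y => y ∈ (DirectSum.coeAddMonoidHom (grading K E)).range)
      (fun x => hof (g := 1) ?_) (fun f => hof (g := FreeGroup.of f) ?_)
      (fun f => hof (g := (FreeGroup.of f)⁻¹) ?_) (AddSubgroup.zero_mem _)
      (fun _ _ h h' => AddSubgroup.add_mem _ h h') (fun c => ?_) (fun y z hy hz => ?_) y
    · change phi K E _ ∈ component K E _; rw [phi_vx]; exact delta_mem_component _ _ _
    · change phi K E _ ∈ component K E _; rw [phi_ed]; exact delta_mem_component _ _ _
    · change phi K E _ ∈ component K E _; rw [phi_gh]; exact delta_mem_component _ _ _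
    · refine hind _ (fun g y hy => hof (g := g) fun h hh => ?_) ?_ ?_
      · change (phi K E (c • y)).1 h = 0
        rw [map_smul, Submodule.coe_smul, Finsupp.smul_apply, (mem_grading.1 hy) h hh, smul_zero]
      · rw [smul_zero]; exact AddSubgroup.zero_mem _
      · intro y z h h'; rw [smul_add]; exact AddSubgroup.add_mem _ h h'
    · revert y
      refine hind _ (fun g y hy => ?_) ?_ ?_
      · revert z
        refine hind _ (fun h z hz => hof (grading_mul_mem hy hz)) ?_ ?_
        · rw [mul_zero]; exact AddSubgroup.zero_mem _
        · intro z z' h h'; rw [mul_add]; exact AddSubgroup.add_mem _ h h'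
      · rw [zero_mul]; exact AddSubgroup.zero_mem _
      · intro z z' h h'; rw [add_mul]; exact AddSubgroup.add_mem _ h h'

variable (K E) in
/-- The family `L_K(E)_g` is a grading of `L_K(E)` by the free group on the edges. -/
theorem grading_isGrading : IsGrading (grading K E) :=
  ⟨@grading_isInternal V A K _ E (fun _ _ => Classical.propDecidable _), grading_mul_mem⟩

end IsGrading

end DirGraph

namespace DirGraph

variable {V : Type u} {A : Type v} {K : Type w} [Field K] {E : DirGraph V A}

/-! Both properties are compared with the loop condition, and both force it through one identity:
$ff^*x = x$ for every edge $f$ and every vertex $x$.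

Why the identity follows. In the skew ring $ff^*$ becomes $1_f\delta_e$ and functions in $D_f$ live
on $X_f$, so $ff^*$ is a left identity on the component of degree $f$ (`ed_gh_mul`). If the grading
is strong, then $x \in L_e = L_f L_{f^{-1}}$ is a sum of products whose left factors are fixed by
$ff^*$. If the grading is clean, write $f = u + a$. A nonzero homogeneous idempotent has degree $e$,
and comparing components in degrees $e$ and $f$ leaves only $a = 0$; so $f$ is a unit, and $ff^*f =
f$ gives $ff^* = 1$.

Why the identity gives a loop (`isLoop_of_ed_gh_mul_vx`). Since $f^*x = 0$ unless $s(f) = x$, every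
vertex is the source of every edge, so there is only one vertex. A second edge $f'$ would give
$r(f') = f'^*s(f')f' = f'^*ff^*s(f')f' = 0$, but vertices are nonzero.

Conversely, let $E$ be a loop. Then $x = ff^* = f^*f$ is the identity, $f$ is a unit, and products
of $f$ and $f^*$ give a unit in each degree, with homogeneous inverse
(`exists_unit_mem_grading_of_loop`). Such units make the grading strong. Moreover $X$ is the single
point $fff\cdots$, so $L_e = \mathbb{K}x$ and every homogeneous element is a scalar multiple of such
a unit. Hence it is zero or a unit, and cleanness is immediate. -/

/-! ### Nonzero generators and their degrees -/

/-- Some boundary path starts at $x$, so $1_x$, the coefficient of $\varphi(x)$ in degree $e$, does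
not vanish. -/
theorem vx_ne_zero (x : V) : vx K E x ≠ 0 := by
  intro h
  obtain ⟨ζ, hζ⟩ := exists_boundaryPath E x
  have h0 : (phi K E (vx K E x)).1 1 = 0 := by rw [h, map_zero]; rfl
  rw [phi_vx] at h0
  have h1 : oneV K E x = 0 := Finsupp.single_eq_same.symm.trans h0
  exact oneV_apply hζ (congrFun h1 ζ)

theorem ed_ne_zero (f : A) : ed K E f ≠ 0 := fun h =>
  vx_ne_zero (K := K) (E := E) (E.rng f) (by rw [← gh_ed, h, mul_zero])

theorem vx_mem_grading (x : V) : vx K E x ∈ grading K E 1 := by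
  change phi K E _ ∈ component K E _
  rw [phi_vx]; exact delta_mem_component _ _ _

theorem ed_mem_grading (f : A) : ed K E f ∈ grading K E (FreeGroup.of f) := by
  change phi K E _ ∈ component K E _
  rw [phi_ed]; exact delta_mem_component _ _ _

theorem gh_mem_grading (f : A) : gh K E f ∈ grading K E (FreeGroup.of f)⁻¹ := by
  change phi K E _ ∈ component K E _
  rw [phi_gh]; exact delta_mem_component _ _ _

/-- The support of $\varphi(y)$ lies in both $\{g\}$ and $\{h\}$, hence is empty, and $\varphi$ is
injective. -/
theorem eq_zero_of_mem_grading {g h : FreeGroup A} {y : LPA K E} (hg : y ∈ grading K E g)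
    (hh : y ∈ grading K E h) (hne : g ≠ h) : y = 0 := by
  refine phi_injective ?_
  rw [map_zero]
  refine Subtype.ext (Finsupp.ext fun k => ?_)
  rcases eq_or_ne k g with rfl | hk
  · exact hh k hne
  · exact hg k hk

/-! ### The element $ff^*$ and the loop criterion -/

/-- A form of `delta_mul` that can be iterated: the product is again a `delta`, and the existential
supplies the membership proof that `delta` needs. -/
theorem delta_mul_eq (g h : FreeGroup A) (r r' : E.BoundaryPath → K) (hr : r ∈ D K E g)
    (hr' : r' ∈ D K E h) : ∃ hm, delta K E g r hr * delta K E h r' hr' =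
      delta K E (g * h) (r * alpha K E g r') hm := by
  have hm := (delta K E g r hr * delta K E h r' hr').2 (g * h)
  rw [delta_mul, Finsupp.single_eq_same] at hm
  exact ⟨hm, Subtype.ext (delta_mul g h r r' hr hr')⟩

/-- The element `f f*` acts as a left identity on the component of degree `f`. -/
theorem ed_gh_mul {f : A} {y : LPA K E} (hy : y ∈ grading K E (FreeGroup.of f)) :
    ed K E f * (gh K E f * y) = y := by
  -- The claim is checked in the skew ring, where an element of degree $f$ is known explicitly: it
  -- is $r\delta_f$ with $r \in D_f$.
  refine phi_injective ?_
  rw [map_mul, map_mul, phi_ed, phi_gh,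
    component_eq (show phi K E y ∈ component K E (FreeGroup.of f) from hy)]
  generalize_proofs h1 h2 h3
  -- From here on only $r \in D_f$ matters.
  generalize (phi K E y).1 (FreeGroup.of f) = r at h3
  obtain ⟨hm, e⟩ := delta_mul_eq _ _ _ _ h2 h3
  rw [e]
  obtain ⟨hm', e'⟩ := delta_mul_eq _ _ _ _ h1 hm
  rw [e']
  refine Subtype.ext ?_
  change Finsupp.single _ _ = Finsupp.single _ _
  congr 1
  · group
  -- It remains to see that $1_f\,\alpha_f(1_{f^{-1}}\,\alpha_{f^{-1}}(r)) = r$. At $\xi =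
  -- \theta_f(\eta)$ both characteristic functions are $1$ and the two translations cancel; off
  -- $X_f$ both sides vanish because $r \in D_f$.
  funext ξ
  by_cases hξ : ξ ∈ E.dom (FreeGroup.of f)
  · obtain ⟨η, hη⟩ := mem_dom_iff.1 hξ
    have hη' : η ∈ E.dom (FreeGroup.of f)⁻¹ := mem_dom_iff.2 ⟨ξ, hη.symm⟩
    rw [Pi.mul_apply, alpha_apply_of hη, Pi.mul_apply, alpha_apply_of hη.symm]
    simp [oneG, hξ, hη']
  · rw [Pi.mul_apply, alpha_apply_not hξ, mul_zero, D_support h3 hξ]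

/-- If `f f*` fixes every vertex for every edge `f`, then the graph is a loop. -/
theorem isLoop_of_ed_gh_mul_vx [Nonempty A]
    (h : ∀ f x, ed K E f * (gh K E f * vx K E x) = vx K E x) : E.IsLoop := by
  have hsrc : ∀ f x, E.src f = x := by
    intro f x
    -- If $s(f) \ne x$ then $f^*x = 0$, and the assumed identity would make $x$ zero.
    by_contra hne
    have := h f x
    rw [gh_vx_ne hne, mul_zero] at this
    exact vx_ne_zero x this.symm
  obtain ⟨f⟩ := ‹Nonempty A›
  refine ⟨E.src f, f, rfl, (hsrc f _).symm, fun y => (hsrc f y).symm, fun f' => ?_⟩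
  by_contra hne
  refine vx_ne_zero (K := K) (E := E) (E.rng f') ?_
  -- This rewrites $r(f')$ as $f'^*\,(ff^*s(f'))\,f'$, which contains the factor $f'^*f = 0$.
  rw [← gh_ed, ← vx_ed f', ← h f (E.src f')]
  simp only [← mul_assoc]
  rw [gh_ed_ne hne]
  simp only [zero_mul]

/-! ### Each graded property forces a loop -/

theorem isLoop_of_isStronglyGraded [Nonempty A] (h : IsStronglyGraded (grading K E)) :
    E.IsLoop := by
  refine isLoop_of_ed_gh_mul_vx (K := K) fun f x => ?_
  have hx := vx_mem_grading (K := K) (E := E) x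
  -- Reading $e$ as $ff^{-1}$ puts $x$ into $L_fL_{f^{-1}}$.
  rw [← mul_inv_cancel (FreeGroup.of f), ← h.mul_eq] at hx
  -- The identity $ff^*y = y$ holds on all of $L_fL_{f^{-1}}$, and for a general $y$ it can be
  -- proved by induction on the additive closure.
  generalize vx K E x = y at hx ⊢
  induction hx using AddSubgroup.closure_induction with
  | mem z hz =>
    obtain ⟨y, hy, y', -, rfl⟩ := hz
    rw [← mul_assoc (gh K E f), ← mul_assoc, ed_gh_mul hy]
  | zero => simp only [mul_zero]
  | add y z _ _ hy hz => rw [mul_add, mul_add, hy, hz]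
  | neg y _ hy => rw [mul_neg, mul_neg, hy]

/-- A homogeneous idempotent is zero or of degree one. -/
theorem eq_one_of_idempotent_mem_grading {h : FreeGroup A} {a : LPA K E}
    (ha : a ∈ grading K E h) (hi : a * a = a) (h0 : a ≠ 0) : h = 1 := by
  by_contra hne
  -- The element $a = a^2$ has both degree $h^2$ and degree $h$; if it is nonzero these agree, so $h
  -- = e$.
  refine h0 (eq_zero_of_mem_grading (g := h * h) (hi ▸ grading_mul_mem ha ha) ha fun e => ?_)
  exact hne (mul_eq_left.1 e)

/-- It is enough to apply cleanness to the edges: the idempotent summand of $f$ must vanish for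
reasons of degree, so $f$ itself is invertible. -/
theorem isLoop_of_isGradedClean [Nonempty A] (h : IsGradedClean (grading K E)) :
    E.IsLoop := by
  obtain ⟨e, he, hc⟩ := h.clean
  refine isLoop_of_ed_gh_mul_vx (K := K) fun f x => ?_
  obtain ⟨u, a, hua, ⟨⟨g, hu⟩, t, hut, -⟩, ⟨k, ha⟩, hi⟩ :=
    hc (ed K E f) ⟨_, ed_mem_grading f⟩
  have ha0 : a = 0 := by
    by_contra h0
    obtain rfl := eq_one_of_idempotent_mem_grading ha hi h0
    -- Suppose $a \ne 0$, so that $a$ has degree $e$. If $u$ has degree $f$, then $a = f - u$ also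
    -- has degree $f \ne e$, so $a = 0$. If not, neither $u$ nor $a$ contributes in degree $f$, so
    -- $f$ would be zero in $L_{\mathbb{K}}(E)$.
    rcases eq_or_ne g (FreeGroup.of f) with rfl | hg
    · refine h0 (eq_zero_of_mem_grading (g := FreeGroup.of f) ?_ ha (FreeGroup.of_ne_one f))
      have : a = ed K E f - u := by rw [hua]; abel
      rw [this]
      exact AddSubgroup.sub_mem _ (ed_mem_grading f) hu
    · refine ed_ne_zero (K := K) (E := E) f (phi_injective ?_)
      rw [map_zero]
      refine Subtype.ext (Finsupp.ext fun l => ?_)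
      rcases eq_or_ne l (FreeGroup.of f) with rfl | hl
      · rw [hua, map_add, Submodule.coe_add, Finsupp.add_apply, mem_grading.1 hu _ hg.symm,
          mem_grading.1 ha _ (FreeGroup.of_ne_one f), add_zero]
        rfl
      · exact mem_grading.1 (ed_mem_grading f) l hl
  rw [ha0, add_zero] at hua
  -- With $x = 1\cdot x = (ft)x$ the goal becomes $ff^*(ft)x = (ft)x$, which follows from $ff^*f =
  -- f\,r(f) = f$.
  rw [← (he (vx K E x)).1, ← hut, ← hua]
  simp only [← mul_assoc]
  rw [mul_assoc (ed K E f) (gh K E f), gh_ed, ed_vx]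

/-! ### The algebra of a loop: identity, homogeneous units, degree $e$ -/

/-- The vertex is the identity of the algebra: it is source and range of the only edge, hence fixes
all generators on both sides. -/
theorem vx_mul_of_loop {x : V} {f : A} (hs : E.src f = x) (hr : E.rng f = x)
    (hV : ∀ y : V, y = x) (hA : ∀ f' : A, f' = f)
    (y : LPA K E) : vx K E x * y = y ∧ y * vx K E x = y := by
  induction y using LPA.induction with
  | hv y => rw [hV y]; exact ⟨vx_mul_self x, vx_mul_self x⟩
  | he f' =>
    rw [hA f']
    exact ⟨by rw [← hs, vx_ed], by rw [← hr, ed_vx]⟩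
  | hg f' =>
    rw [hA f']
    exact ⟨by rw [← hr, vx_gh], by rw [← hs, gh_vx]⟩
  | h0 => simp
  | hadd y z hy hz => rw [mul_add, add_mul, hy.1, hy.2, hz.1, hz.2]; exact ⟨rfl, rfl⟩
  | hsmul c y hy => rw [mul_smul_comm, smul_mul_assoc, hy.1, hy.2]; exact ⟨rfl, rfl⟩
  | hmul y z hy hz => rw [← mul_assoc, hy.1, mul_assoc, hz.2]; exact ⟨rfl, rfl⟩

/-- The sum relation at $x$ has just one term. Together with $f^*f = r(f)$ it makes $f$ invertible
with inverse $f^*$. -/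
theorem ed_mul_gh_of_loop {x : V} {f : A} (hs : E.src f = x) (hA : ∀ f' : A, f' = f) :
    ed K E f * gh K E f = vx K E x := by
  have hset : {f' | E.src f' = x} = {f} := by
    ext f'; simp [hA f', hs]
  have hfin : {f' | E.src f' = x}.Finite := by rw [hset]; exact Set.finite_singleton f
  rw [vx_eq_sum x hfin (by rw [hset]; exact Set.singleton_nonempty f)]
  have : hfin.toFinset = {f} := by ext f'; simp [hA f', hs]
  rw [this, Finset.sum_singleton]

/-- Over a loop every component contains a unit whose inverse is homogeneous. -/
theorem exists_unit_mem_grading_of_loop {x : V} {f : A} (hs : E.src f = x) (hr : E.rng f = x)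
    (hV : ∀ y : V, y = x) (hA : ∀ f' : A, f' = f)
    (g : FreeGroup A) : ∃ u ∈ grading K E g,
    ∃ t ∈ grading K E g⁻¹, u * t = vx K E x ∧ t * u = vx K E x := by
  -- Units with homogeneous inverses are closed under inverses and products, so the edge and its
  -- ghost suffice and the free group need not be identified with $\mathbb{Z}$.
  induction g using FreeGroup.induction_on with
  | C1 =>
    refine ⟨_, vx_mem_grading x, _, ?_, vx_mul_self x, vx_mul_self x⟩
    rw [inv_one]; exact vx_mem_grading x
  | of f' =>
    rw [hA f']
    exact ⟨_, ed_mem_grading f, _, gh_mem_grading f, ed_mul_gh_of_loop hs hA,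
      by rw [gh_ed, hr]⟩
  | inv_of f' h =>
    obtain ⟨u, hu, t, ht, h1, h2⟩ := h
    exact ⟨t, ht, u, by rwa [inv_inv], h2, h1⟩
  | mul g h ihg ihh =>
    obtain ⟨u, hu, t, ht, h1, h2⟩ := ihg
    obtain ⟨u', hu', t', ht', h1', h2'⟩ := ihh
    refine ⟨u * u', grading_mul_mem hu hu', t' * t, ?_, ?_, ?_⟩
    · rw [mul_inv_rev]; exact grading_mul_mem ht' ht
    · rw [mul_assoc, ← mul_assoc u', h1', (vx_mul_of_loop hs hr hV hA t).1, h1]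
    · rw [mul_assoc, ← mul_assoc t, h2, (vx_mul_of_loop hs hr hV hA u').1, h2']

/-- The only vertex emits $f$, so it is not a sink and no boundary path can stop; the only candidate
is $fff\cdots$. -/
theorem subsingleton_boundaryPath_of_loop {x : V} {f : A} (hs : E.src f = x)
    (hV : ∀ y : V, y = x) (hA : ∀ f' : A, f' = f) :
    Subsingleton E.BoundaryPath := by
  refine ⟨fun ξ η => ?_⟩
  have hedge : ∀ (ζ : E.BoundaryPath) n, ζ.edge n = some f := by
    intro ζ n
    cases hn : ζ.edge n with
    | none => exact absurd (hs.trans (hV _).symm) ((ζ.sink_end n hn).1 f)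
    | some f' => rw [hA f']
  ext1
  · funext n; rw [hV (ξ.vert n), hV (η.vert n)]
  · funext n; rw [hedge, hedge]

/-- Functions on a one-point space are constant, so $D_e\delta_e$ is spanned by $1_x\delta_e =
\varphi(x)$. -/
theorem eq_smul_vx_of_loop {x : V} {f : A} (hs : E.src f = x) (hV : ∀ y : V, y = x)
    (hA : ∀ f' : A, f' = f) {y : LPA K E} (hy : y ∈ grading K E 1) :
    ∃ c : K, y = c • vx K E x := by
  have := subsingleton_boundaryPath_of_loop hs hV hA
  obtain ⟨ζ, hζ⟩ := exists_boundaryPath E x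
  -- The scalar is the value of the degree-$e$ coefficient at the unique boundary path.
  refine ⟨(phi K E y).1 1 ζ, phi_injective (Subtype.ext (Finsupp.ext fun g => ?_))⟩
  rw [map_smul, Submodule.coe_smul, Finsupp.smul_apply]
  rcases eq_or_ne g 1 with rfl | hg
  · funext ξ
    rw [Subsingleton.elim ξ ζ, phi_vx]
    change _ = (phi K E y).1 1 ζ * (Finsupp.single 1 (oneV K E x) : FreeGroup A →₀ _) 1 ζ
    simp [oneV, hζ]
  · rw [mem_grading.1 hy g hg, mem_grading.1 (vx_mem_grading x) g hg, smul_zero]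

/-! ### A loop has both graded properties -/

theorem isStronglyGraded_of_loop {x : V} {f : A} (hs : E.src f = x) (hr : E.rng f = x)
    (hV : ∀ y : V, y = x) (hA : ∀ f' : A, f' = f) :
    IsStronglyGraded (grading K E) := by
  refine ⟨grading_isGrading K E, fun g h => le_antisymm ?_ fun z hz => ?_⟩
  · rw [AddSubgroup.closure_le]
    rintro _ ⟨y, hy, z, hz, rfl⟩
    exact grading_mul_mem hy hz
  · obtain ⟨u, hu, t, ht, h1, -⟩ :=
      exists_unit_mem_grading_of_loop (K := K) hs hr hV hA g
    -- A single product suffices: $z = u(tz)$ with $u$ a unit of degree $g$ and $tz$ of degree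
    -- $g^{-1}(gh) = h$.
    refine AddSubgroup.subset_closure ⟨u, hu, t * z, ?_, ?_⟩
    · have := grading_mul_mem ht hz
      rwa [inv_mul_cancel_left] at this
    · rw [← mul_assoc, h1, (vx_mul_of_loop hs hr hV hA z).1]

theorem isGradedClean_of_loop {x : V} {f : A} (hs : E.src f = x) (hr : E.rng f = x)
    (hV : ∀ y : V, y = x) (hA : ∀ f' : A, f' = f) :
    IsGradedClean (grading K E) := by
  have hone := vx_mul_of_loop (K := K) hs hr hV hA
  refine ⟨grading_isGrading K E, vx K E x, hone, ?_⟩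
  rintro y ⟨g, hy⟩
  obtain ⟨u, hu, t, ht, h1, h2⟩ := exists_unit_mem_grading_of_loop (K := K) hs hr hV hA g
  -- Dividing $y$ by the unit $u$ of the same degree lands in degree $e$, where only multiples of
  -- $x$ occur; hence $y = u(ty) = cu$.
  have hty := grading_mul_mem ht hy
  rw [inv_mul_cancel] at hty
  obtain ⟨c, hc⟩ := eq_smul_vx_of_loop hs hV hA hty
  have hyu : y = c • u := by
    rw [← (hone y).1, ← h1, mul_assoc, hc, mul_smul_comm, (hone u).2]
  -- For $c = 0$ the element is zero and is written as $(-x) + x$, a unit plus an idempotent, both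
  -- of degree $e$. For $c \ne 0$ the element $y = cu$ is itself a unit with inverse $c^{-1}t$, and
  -- the idempotent is $0$.
  rcases eq_or_ne c 0 with rfl | hc0
  · refine ⟨-vx K E x, vx K E x, ?_, ⟨⟨1, neg_mem (vx_mem_grading x)⟩, -vx K E x, ?_, ?_⟩,
      ⟨1, vx_mem_grading x⟩, vx_mul_self x⟩
    · rw [hyu, zero_smul, neg_add_cancel]
    · rw [neg_mul_neg, vx_mul_self]
    · rw [neg_mul_neg, vx_mul_self]
  · refine ⟨y, 0, (add_zero y).symm, ⟨⟨g, hy⟩, c⁻¹ • t, ?_, ?_⟩,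
      ⟨1, zero_mem _⟩, mul_zero 0⟩
    · rw [hyu, smul_mul_smul_comm, mul_inv_cancel₀ hc0, one_smul, h1]
    · rw [hyu, smul_mul_smul_comm, inv_mul_cancel₀ hc0, one_smul, h2]

end DirGraph

theorem proposition3p4 {V : Type*} {A : Type*} {K : Type*} [Field K] (E : DirGraph V A)
    [Nonempty A] :
    (IsGradedClean (DirGraph.grading K E) ↔ IsStronglyGraded (DirGraph.grading K E)) ∧
      (IsStronglyGraded (DirGraph.grading K E) ↔ E.IsLoop) := by
  have hstrong : IsStronglyGraded (DirGraph.grading K E) ↔ E.IsLoop :=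
    ⟨DirGraph.isLoop_of_isStronglyGraded, fun ⟨_, _, hs, hr, hV, hA⟩ =>
      DirGraph.isStronglyGraded_of_loop hs hr hV hA⟩
  have hclean : IsGradedClean (DirGraph.grading K E) ↔ E.IsLoop :=
    ⟨DirGraph.isLoop_of_isGradedClean, fun ⟨_, _, hs, hr, hV, hA⟩ =>
      DirGraph.isGradedClean_of_loop hs hr hV hA⟩
  exact ⟨hclean.trans hstrong.symm, hstrong⟩
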